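/- \textbf{Setting.} Let $m\ge 2$ senders and one receiver $r$ play an $n$-stage game. The state is $x_k=Ax_{k-1}+w_{k-1}\in\mathbb R^p$, $k=1,\dots,n$, where $x_0\sim N(0,\Sigma_0)$ and $w_k\sim N(0,\Sigma_w)$ are independent, so $x_k$ has covariance $\Sigma_k=A\Sigma_{k-1}A^\top+\Sigma_w$. At stage $k$ sender $i$ sends $y^i_k=\eta^i_k(x_1,\dots,x_k)\in\mathbb R^p$, and the receiver plays $u_k=\gamma_k\big((y^i_j)_{i\le m,\,j\le k}\big)\in\mathbb R^t$; all policies are Borel. Player $j\in\{1,\dots,m,r\}$ has stage cost $\|Q_{j,k}x_k+R_{j,k}u_k\|^2$ and minimizes the expected sum of its stage costs; $R_{r,k}^\top R_{r,k}$ is invertible. In a multistage hierarchical Nash equilibrium the receiver answers every profile of sender policies with a best response and no sender gains by a unilateral deviation to which the receiver responds; both are required for the costs of stages $1,\dots,K$, for every $K\le n$. The posterior covariance at stage $k$ is $\mathbb E[\hat x_k\hat x_k^\top]$ with $\hat x_k=\mathbb E[x_k\mid (y^i_j)_{i\le m,\,j\le k}]$. Put $\Lambda^i_k=R_{i,k}(R_{r,k}^\top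 R_{r,k})^{-1}R_{r,k}^\top Q_{r,k}$ and $V^i_k=\Lambda_k^{i\top}\Lambda^i_k-\Lambda_k^{i\top}Q_{i,k}-Q_{i,k}^\top\Lambda^i_k$, and let $\succeq$ be the Loewner order. \textbf{Stability.} A matrix $T$ with $\Sigma_k\succeq T\succeq O$ is \emph{stage-stable} for sender $i$ at stage $k$ if it minimizes $\mathrm{Tr}(V^i_kS)$ over $\Sigma_k\succeq S\succeq T$. For $j=1,\dots,n$ let $B_j$ be a map on matrices that is monotone on $\{T: O\preceq T\preceq\Sigma_{j-1}\}$ and satisfies $B_j(T)\preceq\Sigma_j$ there ($B_j(T)$ is the posterior that the other senders induce at stage $j$ when the preceding posterior is $T$). Let $\tilde V^i_{k}(T)$ be the infimum of $\sum_{j=k}^n\mathrm{Tr}(V^i_jS_j)$ over all $S_k,\dots,S_n$ which satisfy, with $S_{k-1}=T$, the constraints $\Sigma_j\succeq S_j$, $S_j\succeq AS_{j-1}A^\top$ and $S_j\succeq B_j(S_{j-1})$ for $k\le j\le n$. The matrix $T$ is \emph{stable for the full cost-to-go} of sender $i$ at stage $k$ if $\Sigma_k\succeq T\succeq O$ and $T$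 minimizes $\mathrm{Tr}(V^i_kS)+\tilde V^i_{k+1}(S)$ over $\Sigma_k\succeq S\succeq T$. \textbf{Greedy posteriors.} Fix for each stage an ordering of the senders. Matrices $S^*_1,\dots,S^*_n$ are \emph{greedy} if, with $S^*_0=O$ and $M_k=\Sigma_k-AS^*_{k-1}A^\top$, for each $k$ one has $S^*_k-AS^*_{k-1}A^\top=T_m$, where $T_0=O$ and, for $j=1,\dots,m$, with $i$ the $j$-th sender in the ordering, $T_j$ is a minimizer of $\mathrm{Tr}(V^i_kS)$ over $M_k\succeq S\succeq T_{j-1}$ which among all such minimizers has the least nuclear norm $\|M_k^{-1/2}SM_k^{-1/2}\|_*$ (with the Moore--Penrose inverse if $M_k$ is singular). \textbf{Claim.} (a) For every choice of orderings greedy $S_1^*,\dots,S_n^*$ exist. (b) For all greedy $S^*_1,\dots,S^*_n$ (with $S^*_0=O$): (i) there are orthogonal projection matrices $P_1,\dots,P_n$ such that, for $k=0,\dots,n-1$, $$S^*_{k+1}=AS^*_{k}A^\top+(\Sigma_{k+1}-AS^*_kA^\top)^{1/2}P_{k+1}(\Sigma_{k+1}-AS^*_kA^\top)^{1/2};$$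 (ii) $S^*_1,\dots,S^*_n$ are equilibrium posteriors: some multistage hierarchical Nash equilibrium has posterior covariance $S^*_k$ at every stage $k$, and in it no unilateral deviation of a sender lowers that sender's expected cost of stages $k,\dots,n$, for any $k$; (iii) each $S^*_k$ is stage-stable, and stable for the full cost-to-go, for every sender and every choice of the maps $B_j$. (c) More generally, every matrix that is stage-stable for a sender at a stage $k\in\{1,\dots,n\}$ is stable for that sender's full cost-to-go at stage $k$, for every choice of the maps $B_j$. -/

import Mathlib

open MeasureTheory ProbabilityTheory
open scoped MatrixOrder Matrix

noncomputable section

/-- Data and standing assumptions of the `n`-stage signaling game between `m` senders and one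
receiver, with state in `ℝ^p`, receiver action in `ℝ^t` and cost matrices with `q` rows.
A player is `some i` (sender `i`) or `none` (the receiver).  Stages are `1, …, n`.
The Loewner order on matrices is `X ≤ Y ↔ (Y - X).PosSemidef`. -/
structure SignalingGame (m p t q : ℕ) where
  /-- number of stages -/
  n : ℕ
  /-- state matrix -/
  A : Matrix (Fin p) (Fin p) ℝ
  /-- covariance of the initial state `x_0` -/
  cov0 : Matrix (Fin p) (Fin p) ℝ
  /-- covariance of the noise -/
  covW : Matrix (Fin p) (Fin p) ℝ
  /-- cost matrices: the stage cost of player `j` at stage `k` is `‖Q j k x_k + R j k u_k‖²` -/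
  Q : Option (Fin m) → ℕ → Matrix (Fin q) (Fin p) ℝ
  R : Option (Fin m) → ℕ → Matrix (Fin q) (Fin t) ℝ
  cov0_posSemidef : cov0.PosSemidef
  covW_posSemidef : covW.PosSemidef
  isUnit_receiver : ∀ k ∈ Finset.Icc 1 n, IsUnit ((R none k)ᵀ * R none k)

/-! ### Policies -/

/-- A policy of a sender: for each stage `k`, a Borel map from the states `(x_1, …, x_k)`
to the message `y_k`. -/
def SenderPolicy (p : ℕ) : Type :=
  ∀ k : ℕ, {f : (Fin k → EuclideanSpace ℝ (Fin p)) → EuclideanSpace ℝ (Fin p) // Measurable f}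

/-- A policy of the receiver: for each stage `k`, a Borel map from all the messages sent at
stages `1, …, k` to the action `u_k`. -/
def ReceiverPolicy (m p t : ℕ) : Type :=
  ∀ k : ℕ, {f : (Fin k → Fin m → EuclideanSpace ℝ (Fin p)) → EuclideanSpace ℝ (Fin t) //
    Measurable f}

/-- A profile of sender policies. -/
abbrev SenderProfile (m p : ℕ) : Type := Fin m → SenderPolicy p

/-- All the messages sent at stages `1, …, k` (the receiver's information at stage `k`);
the index `j : Fin k` stands for stage `j + 1`. -/
def messages {Ω : Type*} {m p : ℕ} (x : ℕ → Ω → EuclideanSpace ℝ (Fin p))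
    (η : SenderProfile m p) (k : ℕ) (ω : Ω) : Fin k → Fin m → EuclideanSpace ℝ (Fin p) :=
  fun j i => (η i (j + 1)).1 (fun l => x (l + 1) ω)

/-- The receiver's estimate `E[x_k | messages up to stage k]`. -/
def estimate {Ω : Type*} [MeasurableSpace Ω] {m p : ℕ} (μ : Measure Ω)
    (x : ℕ → Ω → EuclideanSpace ℝ (Fin p)) (η : SenderProfile m p) (k : ℕ) :
    Ω → EuclideanSpace ℝ (Fin p) :=
  μ[x k | MeasurableSpace.comap (messages x η k) inferInstance]

/-- The posterior covariance `E[x̂_k x̂_kᵀ]` induced at stage `k` by a sender profile. -/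
def posteriorCov {Ω : Type*} [MeasurableSpace Ω] {m p : ℕ} (μ : Measure Ω)
    (x : ℕ → Ω → EuclideanSpace ℝ (Fin p)) (η : SenderProfile m p) (k : ℕ) :
    Matrix (Fin p) (Fin p) ℝ :=
  Matrix.of fun a b => ∫ ω, estimate μ x η k ω a * estimate μ x η k ω b ∂μ

/-! ### Matrix preliminaries and the single-stage sequential procedure -/

/-- `M^{-1/2}` for a positive semidefinite `M` (the Moore-Penrose inverse of `M^{1/2}`, which is
its inverse when `M` is positive definite). -/
def invSqrt {p : ℕ} (M : Matrix (Fin p) (Fin p) ℝ) : Matrix (Fin p) (Fin p) ℝ :=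
  cfc (fun s : ℝ => (Real.sqrt s)⁻¹) M

/-- Nuclear norm: the sum of the singular values, i.e. the trace of `(XᵀX)^{1/2}`. -/
def nuclearNorm {p : ℕ} (X : Matrix (Fin p) (Fin p) ℝ) : ℝ :=
  (CFC.sqrt (Xᵀ * X)).trace

/-- `S` solves `min Tr(V S)` subject to `B ≤ S ≤ M`. -/
def IsSDPSolution {p : ℕ} (V B M S : Matrix (Fin p) (Fin p) ℝ) : Prop :=
  B ≤ S ∧ S ≤ M ∧ ∀ S', B ≤ S' → S' ≤ M → (V * S).trace ≤ (V * S').trace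

/-- `S` has the least normalized nuclear norm among the solutions of `min Tr(V S)`,
`B ≤ S ≤ M`. -/
def IsMinNuclearSolution {p : ℕ} (V B M S : Matrix (Fin p) (Fin p) ℝ) : Prop :=
  IsSDPSolution V B M S ∧ ∀ S', IsSDPSolution V B M S' →
    nuclearNorm (invSqrt M * S * invSqrt M) ≤ nuclearNorm (invSqrt M * S' * invSqrt M)

/-- `S` is returned by the sequential procedure for the single-stage game with prior covariance
`M` and sender matrices `V`: in the order given by `σ`, each sender in turn solves its own
problem, the posterior left by the preceding one being the lower bound. -/
def IsSequentialPosterior {m p : ℕ} (V : Fin m → Matrix (Fin p) (Fin p) ℝ)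
    (M : Matrix (Fin p) (Fin p) ℝ) (σ : Equiv.Perm (Fin m))
    (S : Matrix (Fin p) (Fin p) ℝ) : Prop :=
  ∃ T : ℕ → Matrix (Fin p) (Fin p) ℝ, T 0 = 0 ∧
    (∀ j : Fin m, IsMinNuclearSolution (V (σ j)) (T j) M (T (j + 1))) ∧ T m = S

namespace SignalingGame

variable {m p t q : ℕ} (G : SignalingGame m p t q)

/-! ### The state process -/

/-- `Σ_k`, by the Lyapunov recursion. -/
def stateCov : ℕ → Matrix (Fin p) (Fin p) ℝ
  | 0 => G.cov0
  | k + 1 => G.A * stateCov k * G.Aᵀ + G.covW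

/-- `x_0 ∼ N(0, cov0)` and `x_{k+1} = A x_k + w_k` for `k < n`, where the `w_k ∼ N(0, covW)` and
`x_0` are independent. -/
def IsGaussMarkovState {Ω : Type*} [MeasurableSpace Ω] (μ : Measure Ω)
    (x : ℕ → Ω → EuclideanSpace ℝ (Fin p)) : Prop :=
  ∃ w : ℕ → Ω → EuclideanSpace ℝ (Fin p),
    Measurable (x 0) ∧ (∀ k < G.n, Measurable (w k)) ∧
    μ.map (x 0) = multivariateGaussian 0 G.cov0 ∧
    (∀ k < G.n, μ.map (w k) = multivariateGaussian 0 G.covW) ∧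
    iIndepFun (Fin.cons (x 0) (fun j : Fin G.n => w j) :
      Fin (G.n + 1) → Ω → EuclideanSpace ℝ (Fin p)) μ ∧
    ∀ k < G.n, ∀ ω, x (k + 1) ω = Matrix.toEuclideanLin G.A (x k ω) + w k ω

/-! ### Costs and equilibrium -/

/-- Expected cost of player `j` accumulated over the stages in `s`; a nonnegative quantity,
`∞` when the stage cost is not integrable. -/
def cost {Ω : Type*} [MeasurableSpace Ω] (μ : Measure Ω)
    (x : ℕ → Ω → EuclideanSpace ℝ (Fin p)) (j : Option (Fin m)) (s : Finset ℕ)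
    (η : SenderProfile m p) (γ : ReceiverPolicy m p t) : ENNReal :=
  ∫⁻ ω, ∑ k ∈ s, ENNReal.ofReal
    (‖Matrix.toEuclideanLin (G.Q j k) (x k ω) +
      Matrix.toEuclideanLin (G.R j k) ((γ k).1 (messages x η k ω))‖ ^ 2) ∂μ

/-- Multistage hierarchical Nash equilibrium: `γ` maps every sender profile to a best response of
the receiver, and no sender gains by a unilateral deviation that the receiver responds to; both
requirements are made for the costs of stages `1, …, k`, for every `k ≤ n` (`k = n` is the whole
game). -/
def IsEquilibrium {Ω : Type*} [MeasurableSpace Ω] (μ : Measure Ω)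
    (x : ℕ → Ω → EuclideanSpace ℝ (Fin p)) (η : SenderProfile m p)
    (γ : SenderProfile m p → ReceiverPolicy m p t) : Prop :=
  (∀ k ∈ Finset.Icc 1 G.n, ∀ (η' : SenderProfile m p) (g : ReceiverPolicy m p t),
    G.cost μ x none (Finset.Icc 1 k) η' (γ η') ≤ G.cost μ x none (Finset.Icc 1 k) η' g) ∧
  (∀ k ∈ Finset.Icc 1 G.n, ∀ (i : Fin m) (e : SenderPolicy p),
    G.cost μ x (some i) (Finset.Icc 1 k) η (γ η) ≤
      G.cost μ x (some i) (Finset.Icc 1 k) (Function.update η i e) (γ (Function.update η i e)))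

/-! ### Stable posteriors -/

/-- `Λ_k^i = R_{i,k} (R_{r,k}ᵀ R_{r,k})⁻¹ R_{r,k}ᵀ Q_{r,k}`. -/
def lam (i : Fin m) (k : ℕ) : Matrix (Fin q) (Fin p) ℝ :=
  G.R (some i) k * ((G.R none k)ᵀ * G.R none k)⁻¹ * (G.R none k)ᵀ * G.Q none k

/-- `V_k^i`: up to a constant, sender `i`'s expected cost at stage `k` is `Tr(V_k^i S)` when the
receiver responds optimally with posterior covariance `S`. -/
def V (i : Fin m) (k : ℕ) : Matrix (Fin p) (Fin p) ℝ :=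
  (G.lam i k)ᵀ * G.lam i k - (G.lam i k)ᵀ * G.Q (some i) k - (G.Q (some i) k)ᵀ * G.lam i k

/-- The posterior `T` at stage `k` is stable for sender `i` with respect to the cost of stage `k`
alone: it minimizes `Tr(V_k^i S)` over `Σ_k ≥ S ≥ T`. -/
def IsStageStable (i : Fin m) (k : ℕ) (T : Matrix (Fin p) (Fin p) ℝ) : Prop :=
  0 ≤ T ∧ IsSDPSolution (G.V i k) T (G.stateCov k) T

/-- `B k T` stands for the posterior that the other senders induce at stage `k` when the posterior
at stage `k - 1` is `T`: it is at most `Σ_k` and grows with `T` (it may be constant). -/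
def IsFloor (B : ℕ → Matrix (Fin p) (Fin p) ℝ → Matrix (Fin p) (Fin p) ℝ) : Prop :=
  ∀ k ∈ Finset.Icc 1 G.n,
    (∀ T, 0 ≤ T → T ≤ G.stateCov (k - 1) → B k T ≤ G.stateCov k) ∧
    (∀ T T', 0 ≤ T → T ≤ T' → T' ≤ G.stateCov (k - 1) → B k T ≤ B k T')

/-- `S k, …, S n` are posteriors that sender `i` can aim at, at stages `k, …, n`, after the
posterior `T` at stage `k - 1`, when the others induce `B`: each is at most the state covariance,
and at least both what the receiver already infers from the preceding posterior and what the
others reveal. -/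
def IsContinuation (B : ℕ → Matrix (Fin p) (Fin p) ℝ → Matrix (Fin p) (Fin p) ℝ) (k : ℕ)
    (T : Matrix (Fin p) (Fin p) ℝ) (S : ℕ → Matrix (Fin p) (Fin p) ℝ) : Prop :=
  S (k - 1) = T ∧ ∀ j ∈ Finset.Icc k G.n,
    G.A * S (j - 1) * G.Aᵀ ≤ S j ∧ B j (S (j - 1)) ≤ S j ∧ S j ≤ G.stateCov j

/-- Value function of sender `i`: the least total cost of stages `k, …, n` after the posterior `T`
at stage `k - 1`, when the others induce `B`. -/
def value (B : ℕ → Matrix (Fin p) (Fin p) ℝ → Matrix (Fin p) (Fin p) ℝ) (i : Fin m) (k : ℕ)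
    (T : Matrix (Fin p) (Fin p) ℝ) : ℝ :=
  sInf {c | ∃ S, G.IsContinuation B k T S ∧ c = ∑ j ∈ Finset.Icc k G.n, (G.V i j * S j).trace}

/-- The posterior `T` at stage `k` is stable for sender `i` with respect to the full cost-to-go:
it minimizes `Tr(V_k^i S) + (value from stage k + 1 after S)` over `Σ_k ≥ S ≥ T`. -/
def IsCostToGoStable (B : ℕ → Matrix (Fin p) (Fin p) ℝ → Matrix (Fin p) (Fin p) ℝ) (i : Fin m)
    (k : ℕ) (T : Matrix (Fin p) (Fin p) ℝ) : Prop :=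
  0 ≤ T ∧ T ≤ G.stateCov k ∧ ∀ S, T ≤ S → S ≤ G.stateCov k →
    (G.V i k * T).trace + G.value B i (k + 1) T ≤ (G.V i k * S).trace + G.value B i (k + 1) S

/-- `S 1, …, S n` are computed greedily: `S 0 = 0`, and at each stage `k` the increment
`S k - A (S (k-1)) Aᵀ` is returned by the sequential procedure of the single-stage game with the
stage-`k` costs and prior covariance `Σ_k - A (S (k-1)) Aᵀ`, in the order `σ k`. -/
def IsGreedy (σ : ℕ → Equiv.Perm (Fin m)) (S : ℕ → Matrix (Fin p) (Fin p) ℝ) : Prop :=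
  S 0 = 0 ∧ ∀ k ∈ Finset.Icc 1 G.n,
    IsSequentialPosterior (fun i => G.V i k) (G.stateCov k - G.A * S (k - 1) * G.Aᵀ) (σ k)
      (S k - G.A * S (k - 1) * G.Aᵀ)

end SignalingGame

end

/-! Normalize a feasible `S` of the single-stage problem with prior `M` to `Y = M^{-1/2} S
M^{-1/2}`, so that `0 ≤ Y ≤ 1`. Both `Y²` and `2Y - Y²` are again feasible when the normalized lower
bound is a projection, and their average is `Y`. If `Y` is optimal for a linear functional, so are
both, and `Y²` has smaller trace unless `Y² = Y`. Least nuclear norm therefore forces projections,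
by induction over the senders (`IsMinNuclearSolution.mul_self`, `IsSequentialPosterior.spec`).

Optimality of `T_j` for its sender means `Tr(V X) ≥ 0` for every `0 ≤ X ≤ M - T_j`. This survives
when later senders enlarge the posterior, so the final one is stage-stable for all senders. For the
cost-to-go, a larger posterior leaves fewer continuations, so the value function is monotone
(`value_mono`). A stage-stable posterior thus minimizes the stage cost and the continuation value at
once.

For the equilibrium, all senders use one and the same linear policy, which reveals the part of the
innovation selected by the projection. A Gaussian filter shows that it induces exactly the greedy
posteriors (`posteriorCov_filterPolicy`). With two or more senders, a deviator cannot hide what the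
others still send, so its deviation can only enlarge the posterior covariance, and stage-stability
makes that unprofitable at each stage separately (`stageCost_le_deviation`). -/

section MatrixLemmas

/-! ### Loewner order and projections -/

variable {p : ℕ} {B M S V X Y : Matrix (Fin p) (Fin p) ℝ}

lemma transpose_eq_of_nonneg (h : 0 ≤ X) : Xᵀ = X := by
  simpa using (Matrix.nonneg_iff_posSemidef.1 h).isHermitian.eq

lemma conj_nonneg_of_nonneg {r : ℕ} (h : 0 ≤ X) (C : Matrix (Fin r) (Fin p) ℝ) :
    0 ≤ C * X * Cᵀ := by
  rw [Matrix.nonneg_iff_posSemidef] at h ⊢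
  simpa using h.mul_mul_conjTranspose_same C

lemma conj_mono {r : ℕ} (h : X ≤ Y) (C : Matrix (Fin r) (Fin p) ℝ) :
    C * X * Cᵀ ≤ C * Y * Cᵀ := by
  have := conj_nonneg_of_nonneg (sub_nonneg.2 h) C
  rw [Matrix.mul_sub, Matrix.sub_mul] at this
  exact sub_nonneg.1 this

lemma symm_conj_mono (h : X ≤ Y) {C : Matrix (Fin p) (Fin p) ℝ} (hC : Cᵀ = C) :
    C * X * C ≤ C * Y * C := by
  simpa [hC] using conj_mono h C

lemma mul_self_nonneg_of_symm {C : Matrix (Fin p) (Fin p) ℝ} (hC : Cᵀ = C) : 0 ≤ C * C := by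
  rw [Matrix.nonneg_iff_posSemidef]
  simpa [hC] using Matrix.posSemidef_self_mul_conjTranspose C

lemma trace_nonneg_of_nonneg (h : 0 ≤ X) : 0 ≤ X.trace :=
  (Matrix.nonneg_iff_posSemidef.1 h).trace_nonneg

/-- With `K` the square root of `X`, the hypothesis reads `(K C)ᵀ (K C) = 0`, which forces `K C =
0`. -/
lemma mul_eq_zero_of_conj_eq_zero (hX : 0 ≤ X) {C : Matrix (Fin p) (Fin p) ℝ}
    (h : Cᵀ * X * C = 0) : X * C = 0 := by
  set K := CFC.sqrt X
  have hK : K * K = X := CFC.sqrt_mul_sqrt_self X hX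
  have hKt : Kᵀ = K := transpose_eq_of_nonneg (CFC.sqrt_nonneg X)
  have h2 : K * C = 0 := by
    rw [← Matrix.conjTranspose_mul_self_eq_zero]
    simp only [Matrix.conjTranspose_eq_transpose_of_trivial, Matrix.transpose_mul, hKt]
    rw [← h, ← hK]
    simp only [mul_assoc]
  rw [← hK, mul_assoc, h2, mul_zero]

/-- `Y - Y² = Y (1 - Y) Y + (1 - Y) Y (1 - Y)`, a sum of two nonnegative matrices. -/
lemma mul_self_le_self (h0 : 0 ≤ Y) (h1 : Y ≤ 1) : Y * Y ≤ Y := by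
  have hs := transpose_eq_of_nonneg h0
  have e1 := symm_conj_mono (sub_nonneg.2 h1) hs
  have e2 := symm_conj_mono h0 (C := 1 - Y) (by simp [hs])
  have := add_nonneg (by simpa using e1) (by simpa using e2)
  rw [← sub_nonneg]
  convert this using 1
  noncomm_ring

/-- Compression by `P` squeezes `P Y P` between `P` and `P`, so the nonnegative matrix `1 - Y` has
zero compression and hence kills the range of `P`. -/
lemma mul_eq_of_proj_le {P : Matrix (Fin p) (Fin p) ℝ} (hPs : Pᵀ = P) (hP : P * P = P)
    (h0 : P ≤ Y) (h1 : Y ≤ 1) : Y * P = P := by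
  have e1 : P * Y * P = P := by
    refine le_antisymm ?_ ?_
    · simpa [hP] using symm_conj_mono h1 hPs
    · simpa [hP] using symm_conj_mono h0 hPs
  have e2 : (1 - Y) * P = 0 := by
    refine mul_eq_zero_of_conj_eq_zero (sub_nonneg.2 h1) ?_
    rw [hPs, mul_sub, sub_mul, e1, mul_one, hP, sub_self]
  rw [sub_mul, one_mul, sub_eq_zero] at e2
  exact e2.symm

/-! ### The square root and its Moore-Penrose inverse -/

lemma sqrt_transpose (M : Matrix (Fin p) (Fin p) ℝ) : (CFC.sqrt M)ᵀ = CFC.sqrt M :=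
  transpose_eq_of_nonneg (CFC.sqrt_nonneg M)

lemma invSqrt_transpose (M : Matrix (Fin p) (Fin p) ℝ) : (invSqrt M)ᵀ = invSqrt M := by
  have : IsSelfAdjoint (invSqrt M) := cfc_predicate _ M
  simpa [Matrix.star_eq_conjTranspose] using this.star_eq

lemma sqrt_eq_cfc_real (hM : 0 ≤ M) : CFC.sqrt M = cfc Real.sqrt M := by
  rw [CFC.sqrt_eq_real_sqrt M hM, cfcₙ_eq_cfc]

lemma continuousOn_real_spectrum (f : ℝ → ℝ) : ContinuousOn f (spectrum ℝ M) :=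
  M.finite_real_spectrum.continuousOn f

lemma sqrt_mul_invSqrt_comm (hM : 0 ≤ M) :
    CFC.sqrt M * invSqrt M = invSqrt M * CFC.sqrt M := by
  rw [sqrt_eq_cfc_real hM]
  exact cfc_commute_cfc _ _ M

lemma sqrt_mul_invSqrt_mul_sqrt (hM : 0 ≤ M) :
    CFC.sqrt M * invSqrt M * CFC.sqrt M = CFC.sqrt M := by
  rw [sqrt_eq_cfc_real hM, invSqrt,
    ← cfc_mul _ _ M (continuousOn_real_spectrum _) (continuousOn_real_spectrum _),
    ← cfc_mul _ _ M (continuousOn_real_spectrum _) (continuousOn_real_spectrum _)]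
  congr 1
  ext s
  exact mul_inv_mul_cancel (Real.sqrt s)

lemma invSqrt_mul_sqrt_mul_invSqrt (hM : 0 ≤ M) :
    invSqrt M * CFC.sqrt M * invSqrt M = invSqrt M := by
  rw [sqrt_eq_cfc_real hM, invSqrt,
    ← cfc_mul _ _ M (continuousOn_real_spectrum _) (continuousOn_real_spectrum _),
    ← cfc_mul _ _ M (continuousOn_real_spectrum _) (continuousOn_real_spectrum _)]
  congr 1
  ext s
  simpa using mul_inv_mul_cancel (Real.sqrt s)⁻¹

/-- Needed for singular `M`: `C = 1 - M^{1/2} M^{-1/2}` projects onto the kernel of `M`, and `0 ≤ C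
S C ≤ C M C = 0`, so the kernel of `M` lies in that of `S`. -/
lemma mul_sqrt_mul_invSqrt (hM : 0 ≤ M) (hS0 : 0 ≤ S) (hSM : S ≤ M) :
    S * (CFC.sqrt M * invSqrt M) = S := by
  have hH := sqrt_transpose M
  have hI := invSqrt_transpose M
  have hc := sqrt_mul_invSqrt_comm hM
  set C := 1 - CFC.sqrt M * invSqrt M with hCdef
  have hCt : Cᵀ = C := by
    rw [hCdef, Matrix.transpose_sub, Matrix.transpose_mul, hH, hI, hc, Matrix.transpose_one]
  have hMC : M * C = 0 := by
    have e : M * (CFC.sqrt M * invSqrt M) = M := by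
      calc M * (CFC.sqrt M * invSqrt M)
          = CFC.sqrt M * CFC.sqrt M * (CFC.sqrt M * invSqrt M) := by
            rw [CFC.sqrt_mul_sqrt_self M hM]
        _ = CFC.sqrt M * (CFC.sqrt M * invSqrt M * CFC.sqrt M) := by
            simp only [mul_assoc]; rw [hc]
        _ = M := by rw [sqrt_mul_invSqrt_mul_sqrt hM, CFC.sqrt_mul_sqrt_self M hM]
    rw [hCdef, mul_sub, mul_one, e, sub_self]
  have h1 : C * S * C = 0 := by
    refine le_antisymm ?_ ?_
    · simpa [mul_assoc, hMC] using symm_conj_mono hSM hCt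
    · simpa using symm_conj_mono hS0 hCt
  have h2 : S * C = 0 := mul_eq_zero_of_conj_eq_zero hS0 (by rw [hCt, h1])
  rw [hCdef, mul_sub, mul_one, sub_eq_zero] at h2
  exact h2.symm

lemma nuclearNorm_of_nonneg (h : 0 ≤ X) : nuclearNorm X = X.trace := by
  rw [nuclearNorm, transpose_eq_of_nonneg h, CFC.sqrt_mul_self X h]

lemma nuclearNorm_invSqrt (hS : 0 ≤ S) :
    nuclearNorm (invSqrt M * S * invSqrt M) = (invSqrt M * S * invSqrt M).trace :=
  nuclearNorm_of_nonneg (by simpa using symm_conj_mono hS (invSqrt_transpose M))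

/-- Normalization by the Moore-Penrose inverse loses nothing on the interval `[0, M]`. -/
lemma sqrt_conj_invSqrt_conj (hM : 0 ≤ M) (hS0 : 0 ≤ S) (hSM : S ≤ M) :
    CFC.sqrt M * (invSqrt M * S * invSqrt M) * CFC.sqrt M = S := by
  have h1 := mul_sqrt_mul_invSqrt hM hS0 hSM
  have h2 : CFC.sqrt M * invSqrt M * S = S := by
    have := congrArg Matrix.transpose h1
    rwa [Matrix.transpose_mul, Matrix.transpose_mul, sqrt_transpose, invSqrt_transpose,
      transpose_eq_of_nonneg hS0, ← sqrt_mul_invSqrt_comm hM] at this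
  calc _ = CFC.sqrt M * invSqrt M * S * (invSqrt M * CFC.sqrt M) := by simp only [mul_assoc]
    _ = S := by rw [h2, ← sqrt_mul_invSqrt_comm hM, h1]

/-! ### Solutions of the trace problem of least nuclear norm -/

/-- `I S I` is a projection (`I` the inverse square root of `M`) if `S` has least nuclear norm
among the minimizers of a linear functional on the order interval `[B, M]`, and `I B I` is a
projection. -/
lemma IsMinNuclearSolution.mul_self (hM : 0 ≤ M) (hB : 0 ≤ B)
    (hP : invSqrt M * B * invSqrt M * (invSqrt M * B * invSqrt M) = invSqrt M * B * invSqrt M)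
    (h : IsMinNuclearSolution V B M S) :
    invSqrt M * S * invSqrt M * (invSqrt M * S * invSqrt M) = invSqrt M * S * invSqrt M := by
  obtain ⟨⟨hBS, hSM, hopt⟩, hmin⟩ := h
  have hS0 := hB.trans hBS
  have hHt := sqrt_transpose M
  have hIt := invSqrt_transpose M
  have hc := sqrt_mul_invSqrt_comm hM
  have hHIH := sqrt_mul_invSqrt_mul_sqrt hM
  have hIHI := invSqrt_mul_sqrt_mul_invSqrt hM
  have hHH := CFC.sqrt_mul_sqrt_self M hM
  have hS := sqrt_conj_invSqrt_conj hM hS0 hSM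
  have hBP := sqrt_conj_invSqrt_conj hM hB (hBS.trans hSM)
  set H := CFC.sqrt M with hH
  set I := invSqrt M with hI
  set P := I * B * I with hPdef
  set Y := I * S * I with hYdef
  set E := I * H with hE
  have hPt : Pᵀ = P := by
    simp [hPdef, Matrix.transpose_mul, hIt, transpose_eq_of_nonneg hB, mul_assoc]
  have hY0 : 0 ≤ Y := by simpa using symm_conj_mono hS0 hIt
  have hYt : Yᵀ = Y := transpose_eq_of_nonneg hY0
  have hEt : Eᵀ = E := by rw [hE, Matrix.transpose_mul, hHt, hIt, hc]
  have hEE : E * E = E := by rw [hE, ← mul_assoc, hIHI]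
  have hE1 : E ≤ 1 := by
    have := mul_self_nonneg_of_symm (C := 1 - E) (by simp [hEt])
    rw [← sub_nonneg]
    convert this using 1
    rw [mul_sub, mul_one, sub_mul, one_mul, hEE, sub_self, sub_zero]
  have hPY : P ≤ Y := symm_conj_mono hBS hIt
  have hYE : Y ≤ E := by
    have := symm_conj_mono hSM hIt
    rwa [← hHH, ← mul_assoc, mul_assoc (I * H), hc, hEE] at this
  have hY1 := hYE.trans hE1
  have hEY : E * Y = Y := by
    rw [hYdef, ← mul_assoc, ← mul_assoc, hE, hIHI]
  have hYE' : Y * E = Y := by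
    rw [hYdef, ← hc, mul_assoc, ← mul_assoc I, ← hE, hIHI]
  have hYP := mul_eq_of_proj_le hPt hP hPY hY1
  have hPY' : P * Y = P := by
    simpa [Matrix.transpose_mul, hYt, hPt] using congrArg Matrix.transpose hYP
  -- Since `Y P = P = P Y`, the difference `Y² - P` is the square `(Y - P)²`.
  have hP_le : P ≤ Y * Y := by
    have := mul_self_nonneg_of_symm (C := Y - P) (by simp [hYt, hPt])
    rw [← sub_nonneg]
    convert this using 1
    rw [mul_sub, sub_mul, sub_mul, hYP, hPY', hP]
    abel
  have hYY := mul_self_le_self hY0 hY1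
  have hHEH : H * E * H = M := by
    rw [hE, ← mul_assoc, hHIH, hHH]
  have h1B : B ≤ H * (Y * Y) * H := by
    have := symm_conj_mono hP_le hHt
    rwa [hBP] at this
  have h1M : H * (Y * Y) * H ≤ M := by
    have := symm_conj_mono (hYY.trans hYE) hHt
    rwa [hHEH] at this
  -- The second candidate `2Y - Y²` is the reflection of `Y²` in `Y`. Its upper bound holds because
  -- `E - (2Y - Y²) = (E - Y)²`, where `E` is the projection onto the range of `M`.
  have h2B : B ≤ H * (Y + (Y - Y * Y)) * H := by
    have := symm_conj_mono (hPY.trans (le_add_of_nonneg_right (sub_nonneg.2 hYY))) hHt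
    rwa [hBP] at this
  have h2M : H * (Y + (Y - Y * Y)) * H ≤ M := by
    have e : Y + (Y - Y * Y) ≤ E := by
      have := mul_self_nonneg_of_symm (C := E - Y) (by simp [hYt, hEt])
      rw [← sub_nonneg]
      convert this using 1
      rw [mul_sub, sub_mul, sub_mul, hEE, hEY, hYE']
      abel
    have := symm_conj_mono e hHt
    rwa [hHEH] at this
  have o1 := hopt _ h1B h1M
  have o2 := hopt _ h2B h2M
  have hsum : (V * (H * (Y + (Y - Y * Y)) * H)).trace + (V * (H * (Y * Y) * H)).trace
      = 2 * (V * S).trace := by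
    rw [← Matrix.trace_add, ← mul_add, ← add_mul, ← mul_add]
    have : Y + (Y - Y * Y) + Y * Y = Y + Y := by abel
    rw [this, mul_add, add_mul, hS, mul_add, Matrix.trace_add]
    ring
  -- Two feasible points whose average is optimal are both optimal. So `Y²` competes for the least
  -- nuclear norm, while `Y² ≤ Y`: the traces agree and `Y - Y² = 0`.
  have hsol : IsSDPSolution V B M (H * (Y * Y) * H) :=
    ⟨h1B, h1M, fun S' a b => by linarith [hopt S' a b]⟩
  have hn := hmin _ hsol
  rw [nuclearNorm_invSqrt hS0, nuclearNorm_invSqrt (hB.trans h1B)] at hn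
  have e3 : I * (H * (Y * Y) * H) * I = Y * Y := by
    calc _ = (E * Y) * (Y * (H * I)) := by simp only [hE, mul_assoc]
      _ = Y * Y := by rw [hc, hEY, hYE']
  rw [← hI, e3, ← hYdef] at hn
  have hz : (Y - Y * Y).trace = 0 := by
    have := trace_nonneg_of_nonneg (sub_nonneg.2 hYY)
    rw [Matrix.trace_sub] at this ⊢
    linarith
  have := (Matrix.nonneg_iff_posSemidef.1 (sub_nonneg.2 hYY)).trace_eq_zero_iff.1 hz
  exact (sub_eq_zero.1 this).symm

/-- Testing the quadratic form on `e_a ± e_b` gives `2 |X a b| ≤ X a a + X b b`, and each diagonal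
entry is at most the trace. -/
lemma abs_apply_le_trace (h : 0 ≤ X) (a b : Fin p) : |X a b| ≤ X.trace := by
  have hX := Matrix.nonneg_iff_posSemidef.1 h
  have hd : ∀ i, 0 ≤ X i i := fun i => hX.diag_nonneg
  have ht : ∀ i, X i i ≤ X.trace := fun i =>
    Finset.single_le_sum (f := fun i => X i i) (fun i _ => hd i) (Finset.mem_univ i)
  have hs : X b a = X a b := congrFun (congrFun (transpose_eq_of_nonneg h) a) b
  have q : ∀ s : ℝ, 0 ≤ X a a + s * (X a b + X b a) + s * s * X b b := by
    intro s
    have := hX.dotProduct_mulVec_nonneg (Pi.single a 1 + s • Pi.single b 1)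
    simp only [star_trivial, Matrix.mulVec_add, Matrix.mulVec_smul, Matrix.mulVec_single_one,
      dotProduct_add, add_dotProduct, smul_dotProduct, dotProduct_smul, single_one_dotProduct,
      Matrix.col_apply, smul_eq_mul] at this
    linarith
  have q1 := q 1
  have q2 := q (-1)
  rw [hs] at q1 q2
  rw [abs_le]
  constructor <;> linarith [ht a, ht b]

lemma isClosed_setOf_nonneg_matrix : IsClosed {X : Matrix (Fin p) (Fin p) ℝ | 0 ≤ X} := by
  have : {X : Matrix (Fin p) (Fin p) ℝ | 0 ≤ X} =
      {X | Xᵀ = X} ∩ ⋂ v : Fin p → ℝ, {X | 0 ≤ v ⬝ᵥ X *ᵥ v} := by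
    ext X
    simp only [Set.mem_ofPred_eq, Matrix.nonneg_iff_posSemidef,
      Matrix.posSemidef_iff_dotProduct_mulVec, Set.mem_inter_iff, Set.mem_iInter]
    simp [Matrix.IsHermitian]
  rw [this]
  refine (isClosed_eq (by fun_prop) (by fun_prop)).inter (isClosed_iInter fun v => ?_)
  exact isClosed_le continuous_const (by fun_prop)

lemma isCompact_loewner_Icc (hB : 0 ≤ B) :
    IsCompact {X : Matrix (Fin p) (Fin p) ℝ | B ≤ X ∧ X ≤ M} := by
  have hK : IsCompact (Set.univ.pi fun _ : Fin p => Set.univ.pi fun _ : Fin p =>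
      Set.Icc (-M.trace) M.trace) :=
    isCompact_univ_pi fun _ => isCompact_univ_pi fun _ => isCompact_Icc
  refine IsCompact.of_isClosed_subset hK ?_ ?_
  · have h1 : IsClosed {X : Matrix (Fin p) (Fin p) ℝ | B ≤ X} := by
      have := isClosed_setOf_nonneg_matrix.preimage (f := fun X : Matrix (Fin p) (Fin p) ℝ => X - B)
        (continuous_id.sub continuous_const)
      simpa only [Set.preimage, Set.mem_ofPred_eq, sub_nonneg] using this
    have h2 : IsClosed {X : Matrix (Fin p) (Fin p) ℝ | X ≤ M} := by
      have := isClosed_setOf_nonneg_matrix.preimage (f := fun X : Matrix (Fin p) (Fin p) ℝ => M - X)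
        (continuous_const.sub continuous_id)
      simpa only [Set.preimage, Set.mem_ofPred_eq, sub_nonneg] using this
    exact h1.inter h2
  · rintro X ⟨h1, h2⟩ a - b -
    have ht : X.trace ≤ M.trace := by
      have := trace_nonneg_of_nonneg (sub_nonneg.2 h2)
      rw [Matrix.trace_sub] at this
      linarith
    exact abs_le.1 ((abs_apply_le_trace (hB.trans h1) a b).trans ht)

/-- Two successive minimizations of continuous functions on compact sets; on nonnegative matrices
the nuclear norm is the trace, hence linear. -/
lemma exists_isMinNuclearSolution (V : Matrix (Fin p) (Fin p) ℝ) (hB : 0 ≤ B) (hBM : B ≤ M) :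
    ∃ S, IsMinNuclearSolution V B M S := by
  have hK := isCompact_loewner_Icc (M := M) hB
  obtain ⟨S₀, hS₀, hmin₀⟩ := hK.exists_isMinOn ⟨B, le_rfl, hBM⟩
    (f := fun S => (V * S).trace) (by fun_prop)
  have hK' : IsCompact ({X : Matrix (Fin p) (Fin p) ℝ | B ≤ X ∧ X ≤ M} ∩
      {S | (V * S).trace ≤ (V * S₀).trace}) :=
    hK.inter_right (isClosed_le (by fun_prop) continuous_const)
  obtain ⟨S, hS, hmin⟩ := hK'.exists_isMinOn ⟨S₀, hS₀, le_refl (V * S₀).trace⟩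
    (f := fun S => (invSqrt M * S * invSqrt M).trace) (by fun_prop)
  refine ⟨S, ⟨hS.1.1, hS.1.2, fun S' a b => le_trans hS.2 (hmin₀ ⟨a, b⟩)⟩, fun S' hS' => ?_⟩
  rw [nuclearNorm_invSqrt (hB.trans hS.1.1), nuclearNorm_invSqrt (hB.trans hS'.1)]
  exact hmin ⟨⟨hS'.1, hS'.2.1⟩, hS'.2.2 S₀ hS₀.1 hS₀.2⟩

/-! ### Sequential procedure -/

/-- Optimality compared with `S + X`. In this form the condition survives when `S` is replaced by
something larger. -/
lemma IsSDPSolution.trace_nonneg (h : IsSDPSolution V B M S) (hX : 0 ≤ X) (hXM : X ≤ M - S) :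
    0 ≤ (V * X).trace := by
  have := h.2.2 (S + X) (h.1.trans (le_add_of_nonneg_right hX))
    (by rw [add_comm]; exact le_sub_iff_add_le.1 hXM)
  rw [mul_add, Matrix.trace_add] at this
  linarith

lemma exists_isSequentialPosterior {m : ℕ} (V : Fin m → Matrix (Fin p) (Fin p) ℝ)
    (hM : 0 ≤ M) (σ : Equiv.Perm (Fin m)) : ∃ S, IsSequentialPosterior V M σ S := by
  have step : ∀ (j : ℕ) (T : {T : Matrix (Fin p) (Fin p) ℝ // 0 ≤ T ∧ T ≤ M}),
      ∃ T' : {T : Matrix (Fin p) (Fin p) ℝ // 0 ≤ T ∧ T ≤ M},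
        ∀ h : j < m, IsMinNuclearSolution (V (σ ⟨j, h⟩)) T.1 M T'.1 := by
    intro j T
    by_cases h : j < m
    · obtain ⟨S, hS⟩ := exists_isMinNuclearSolution (V (σ ⟨j, h⟩)) T.2.1 T.2.2
      exact ⟨⟨S, T.2.1.trans hS.1.1, hS.1.2.1⟩, fun _ => hS⟩
    · exact ⟨T, fun h' => absurd h' h⟩
  choose f hf using step
  let T : ℕ → {T : Matrix (Fin p) (Fin p) ℝ // 0 ≤ T ∧ T ≤ M} :=
    fun j => Nat.rec ⟨0, le_rfl, hM⟩ f j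
  exact ⟨(T m).1, fun j => (T j).1, rfl, fun j => hf j (T j) j.2, rfl⟩

/-- Each posterior is the lower bound of the next problem, so the projection property passes along,
starting from `0`. The inequalities of earlier senders persist because `M - T j` shrinks with `j`.
-/
lemma IsSequentialPosterior.spec {m : ℕ} {V : Fin m → Matrix (Fin p) (Fin p) ℝ}
    (hM : 0 ≤ M) {σ : Equiv.Perm (Fin m)} (h : IsSequentialPosterior V M σ S) :
    0 ≤ S ∧ S ≤ M ∧
    invSqrt M * S * invSqrt M * (invSqrt M * S * invSqrt M) = invSqrt M * S * invSqrt M ∧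
    ∀ i X, 0 ≤ X → X ≤ M - S → 0 ≤ (V i * X).trace := by
  obtain ⟨T, hT0, hT, rfl⟩ := h
  have key : ∀ j ≤ m, 0 ≤ T j ∧ T j ≤ M ∧
      invSqrt M * T j * invSqrt M * (invSqrt M * T j * invSqrt M) = invSqrt M * T j * invSqrt M ∧
      ∀ l : Fin m, l < j → ∀ X, 0 ≤ X → X ≤ M - T j → 0 ≤ (V (σ l) * X).trace := by
    intro j
    induction j with
    | zero => intro _; simp [hT0, hM]
    | succ j ih =>
      intro hj
      obtain ⟨h0, h1, h2, h3⟩ := ih (by omega)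
      have hs := hT ⟨j, hj⟩
      refine ⟨h0.trans hs.1.1, hs.1.2.1, hs.mul_self hM h0 h2, fun l hl X hX hXM => ?_⟩
      rcases Nat.lt_succ_iff_lt_or_eq.1 hl with hl | hl
      · exact h3 l hl X hX (hXM.trans (sub_le_sub_left hs.1.1 M))
      · have : l = ⟨j, hj⟩ := Fin.ext hl
        subst this
        exact hs.1.trace_nonneg hX hXM
  obtain ⟨h0, h1, h2, h3⟩ := key m le_rfl
  refine ⟨h0, h1, h2, fun i X hX hXM => ?_⟩
  have := h3 (σ.symm i) (σ.symm i).2 X hX hXM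
  rwa [Equiv.apply_symm_apply] at this

end MatrixLemmas

/-! ### Stability and greedy posteriors of the game -/

namespace SignalingGame

variable {m p t q : ℕ} (G : SignalingGame m p t q)

lemma stateCov_nonneg (k : ℕ) : 0 ≤ G.stateCov k := by
  induction k with
  | zero => exact Matrix.nonneg_iff_posSemidef.2 G.cov0_posSemidef
  | succ k ih =>
    exact add_nonneg (conj_nonneg_of_nonneg ih _) (Matrix.nonneg_iff_posSemidef.2 G.covW_posSemidef)

lemma conj_le_stateCov_succ {k : ℕ} {T : Matrix (Fin p) (Fin p) ℝ} (h : T ≤ G.stateCov k) :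
    G.A * T * G.Aᵀ ≤ G.stateCov (k + 1) :=
  (conj_mono h _).trans (le_add_of_nonneg_right (Matrix.nonneg_iff_posSemidef.2 G.covW_posSemidef))

lemma conj_le_stateCov {k : ℕ} (hk : 1 ≤ k) {T : Matrix (Fin p) (Fin p) ℝ}
    (h : T ≤ G.stateCov (k - 1)) : G.A * T * G.Aᵀ ≤ G.stateCov k := by
  obtain ⟨k, rfl⟩ := Nat.exists_eq_add_of_le' hk
  exact G.conj_le_stateCov_succ h

/-! ### Cost-to-go -/

/-- Nonnegativity is not part of `IsContinuation`; it propagates from `T` through `A S Aᵀ ≤ S'`. -/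
lemma IsContinuation.nonneg {G : SignalingGame m p t q}
    {B : ℕ → Matrix (Fin p) (Fin p) ℝ → Matrix (Fin p) (Fin p) ℝ} {k : ℕ} (hk : 1 ≤ k)
    {T : Matrix (Fin p) (Fin p) ℝ} {S : ℕ → Matrix (Fin p) (Fin p) ℝ}
    (h : G.IsContinuation B k T S) (hT : 0 ≤ T) {j : ℕ} (hkj : k ≤ j + 1) (hj : j ≤ G.n) :
    0 ≤ S j := by
  induction j with
  | zero => rw [show (0 : ℕ) = k - 1 by omega, h.1]; exact hT
  | succ j ih =>
    rcases Nat.lt_or_ge (j + 1) k with hlt | hge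
    · rw [show j + 1 = k - 1 by omega, h.1]; exact hT
    · have h1 := (h.2 (j + 1) (Finset.mem_Icc.2 ⟨hge, hj⟩)).1
      exact (conj_nonneg_of_nonneg (ih hge (by omega)) _).trans h1

lemma abs_trace_mul_le {V S M : Matrix (Fin p) (Fin p) ℝ} (h0 : 0 ≤ S) (h1 : S ≤ M) :
    |(V * S).trace| ≤ ∑ a, ∑ b, |V a b| * M.trace := by
  have ht : S.trace ≤ M.trace := by
    have := trace_nonneg_of_nonneg (sub_nonneg.2 h1)
    rw [Matrix.trace_sub] at this
    linarith
  rw [Matrix.trace]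
  refine (Finset.abs_sum_le_sum_abs _ _).trans (Finset.sum_le_sum fun a _ => ?_)
  rw [Matrix.diag_apply, Matrix.mul_apply]
  refine (Finset.abs_sum_le_sum_abs _ _).trans (Finset.sum_le_sum fun b _ => ?_)
  rw [abs_mul]
  exact mul_le_mul_of_nonneg_left ((abs_apply_le_trace h0 b a).trans ht) (abs_nonneg _)

/-- A real `sInf` defaults to `0` on sets that are empty or unbounded below; this lemma and
`exists_continuation` exclude both cases. -/
lemma bddBelow_continuation_cost
    (B : ℕ → Matrix (Fin p) (Fin p) ℝ → Matrix (Fin p) (Fin p) ℝ) (i : Fin m) {k : ℕ} (hk : 1 ≤ k)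
    {T : Matrix (Fin p) (Fin p) ℝ} (hT : 0 ≤ T) :
    BddBelow {c | ∃ S, G.IsContinuation B k T S ∧
      c = ∑ j ∈ Finset.Icc k G.n, (G.V i j * S j).trace} := by
  refine ⟨∑ j ∈ Finset.Icc k G.n, -∑ a, ∑ b, |G.V i j a b| * (G.stateCov j).trace, ?_⟩
  rintro c ⟨S, hS, rfl⟩
  refine Finset.sum_le_sum fun j hj => ?_
  have hj' := Finset.mem_Icc.1 hj
  exact (abs_le.1 (abs_trace_mul_le (hS.nonneg hk hT (by omega) hj'.2) (hS.2 j hj).2.2)).1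

/-- Full revelation from stage `k + 1` on meets every constraint. -/
lemma exists_continuation {B : ℕ → Matrix (Fin p) (Fin p) ℝ → Matrix (Fin p) (Fin p) ℝ}
    (hB : G.IsFloor B) (k : ℕ) {T : Matrix (Fin p) (Fin p) ℝ} (hT0 : 0 ≤ T)
    (hT : T ≤ G.stateCov k) : ∃ S, G.IsContinuation B (k + 1) T S := by
  refine ⟨fun j => if j = k then T else G.stateCov j, by simp, fun j hj => ?_⟩
  obtain ⟨h1, h2⟩ := Finset.mem_Icc.1 hj
  have hjk : j ≠ k := by omega
  have hmem : j ∈ Finset.Icc 1 G.n := Finset.mem_Icc.2 ⟨by omega, h2⟩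
  simp only [hjk, if_false]
  have hprev : 0 ≤ (if j - 1 = k then T else G.stateCov (j - 1)) ∧
      (if j - 1 = k then T else G.stateCov (j - 1)) ≤ G.stateCov (j - 1) := by
    split_ifs with h
    · subst h; exact ⟨hT0, hT⟩
    · exact ⟨G.stateCov_nonneg _, le_rfl⟩
  exact ⟨G.conj_le_stateCov (by omega) hprev.2, (hB j hmem).1 _ hprev.1 hprev.2, le_rfl⟩

/-- The preceding posterior enters only through the lower bounds at stage `k + 1`, and these are
monotone in it. Only the entry at `k`, which records that posterior, has to be changed. -/
lemma IsContinuation.of_le {G : SignalingGame m p t q}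
    {B : ℕ → Matrix (Fin p) (Fin p) ℝ → Matrix (Fin p) (Fin p) ℝ} (hB : G.IsFloor B) {k : ℕ}
    {T T' : Matrix (Fin p) (Fin p) ℝ} (hT : 0 ≤ T) (hTT' : T ≤ T') (hT' : T' ≤ G.stateCov k)
    {S : ℕ → Matrix (Fin p) (Fin p) ℝ} (h : G.IsContinuation B (k + 1) T' S) :
    G.IsContinuation B (k + 1) T (Function.update S k T) := by
  refine ⟨by simp, fun j hj => ?_⟩
  obtain ⟨h1, h2⟩ := Finset.mem_Icc.1 hj
  rw [Function.update_of_ne (by omega : j ≠ k)]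
  obtain ⟨c1, c2, c3⟩ := h.2 j hj
  by_cases hjk : j - 1 = k
  · have hS : S (j - 1) = T' := by rw [hjk]; simpa using h.1
    rw [hS] at c1 c2
    rw [hjk, Function.update_self]
    refine ⟨(conj_mono hTT' _).trans c1,
      ((hB j (Finset.mem_Icc.2 ⟨by omega, h2⟩)).2 _ _ hT hTT' (by rwa [hjk])).trans c2, c3⟩
  · rw [Function.update_of_ne hjk]
    exact ⟨c1, c2, c3⟩

/-- The value function grows with the preceding posterior. -/
lemma value_mono {B : ℕ → Matrix (Fin p) (Fin p) ℝ → Matrix (Fin p) (Fin p) ℝ}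
    (hB : G.IsFloor B) (i : Fin m) (k : ℕ) {T T' : Matrix (Fin p) (Fin p) ℝ} (hT : 0 ≤ T)
    (hTT' : T ≤ T') (hT' : T' ≤ G.stateCov k) :
    G.value B i (k + 1) T ≤ G.value B i (k + 1) T' := by
  obtain ⟨S₀, hS₀⟩ := G.exists_continuation hB k (hT.trans hTT') hT'
  -- Every continuation after `T'` gives one after `T` with the same costs, so the infimum for `T`
  -- is over a larger set.
  refine csInf_le_csInf (G.bddBelow_continuation_cost B i (by omega) hT) ⟨_, S₀, hS₀, rfl⟩ ?_
  rintro c ⟨S, hS, rfl⟩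
  refine ⟨_, hS.of_le hB hT hTT' hT', Finset.sum_congr rfl fun j hj => ?_⟩
  rw [Function.update_of_ne (by have := Finset.mem_Icc.1 hj; omega : j ≠ k)]

/-- `T` minimizes the stage cost by hypothesis and the value by monotonicity, so it minimizes their
sum. -/
lemma IsStageStable.isCostToGoStable {G : SignalingGame m p t q} {i : Fin m} {k : ℕ}
    {T : Matrix (Fin p) (Fin p) ℝ} (h : G.IsStageStable i k T)
    {B : ℕ → Matrix (Fin p) (Fin p) ℝ → Matrix (Fin p) (Fin p) ℝ} (hB : G.IsFloor B) :
    G.IsCostToGoStable B i k T :=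
  ⟨h.1, h.2.2.1, fun _ hTS hS => add_le_add (h.2.2.2 _ hTS hS) (G.value_mono hB i k h.1 hTS hS)⟩

/-! ### Greedy posteriors -/

/-- The recursion carries the bound by the state covariance, which keeps the next prior covariance
nonnegative. -/
lemma exists_isGreedy (σ : ℕ → Equiv.Perm (Fin m)) : ∃ S, G.IsGreedy σ S := by
  have step : ∀ (k : ℕ) (T : {T : Matrix (Fin p) (Fin p) ℝ // T ≤ G.stateCov k}),
      ∃ T' : {T : Matrix (Fin p) (Fin p) ℝ // T ≤ G.stateCov (k + 1)},
        IsSequentialPosterior (fun i => G.V i (k + 1)) (G.stateCov (k + 1) - G.A * T.1 * G.Aᵀ)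
          (σ (k + 1)) (T'.1 - G.A * T.1 * G.Aᵀ) := by
    intro k T
    have hM := sub_nonneg.2 (G.conj_le_stateCov_succ T.2)
    obtain ⟨S, hS⟩ := exists_isSequentialPosterior (fun i => G.V i (k + 1)) hM (σ (k + 1))
    exact ⟨⟨S + G.A * T.1 * G.Aᵀ, le_sub_iff_add_le.1 (hS.spec hM).2.1⟩, by simpa using hS⟩
  choose f hf using step
  let S : (k : ℕ) → {T : Matrix (Fin p) (Fin p) ℝ // T ≤ G.stateCov k} :=
    fun k => Nat.rec ⟨0, G.stateCov_nonneg 0⟩ f k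
  refine ⟨fun k => (S k).1, rfl, fun k hk => ?_⟩
  obtain ⟨k, rfl⟩ := Nat.exists_eq_add_of_le' (Finset.mem_Icc.1 hk).1
  exact hf k (S k)

variable {G} {σ : ℕ → Equiv.Perm (Fin m)} {S : ℕ → Matrix (Fin p) (Fin p) ℝ}

lemma IsGreedy.bounds (h : G.IsGreedy σ S) {k : ℕ} (hk : k ≤ G.n) :
    0 ≤ S k ∧ S k ≤ G.stateCov k := by
  induction k with
  | zero => rw [h.1]; exact ⟨le_rfl, G.stateCov_nonneg 0⟩
  | succ k ih =>
    obtain ⟨h0, h1⟩ := ih (by omega)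
    have hs := (h.2 (k + 1) (Finset.mem_Icc.2 ⟨by omega, hk⟩)).spec
      (sub_nonneg.2 (G.conj_le_stateCov_succ h1))
    exact ⟨(conj_nonneg_of_nonneg h0 _).trans (sub_nonneg.1 hs.1), by simpa using hs.2.1⟩

lemma IsGreedy.prior_nonneg (h : G.IsGreedy σ S) {k : ℕ} (hk : k ∈ Finset.Icc 1 G.n) :
    0 ≤ G.stateCov k - G.A * S (k - 1) * G.Aᵀ := by
  obtain ⟨h1, h2⟩ := Finset.mem_Icc.1 hk
  exact sub_nonneg.2 (G.conj_le_stateCov h1 (h.bounds (by omega)).2)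

lemma IsGreedy.isStageStable (h : G.IsGreedy σ S) {k : ℕ} (hk : k ∈ Finset.Icc 1 G.n)
    (i : Fin m) : G.IsStageStable i k (S k) := by
  obtain ⟨h0, h1⟩ := h.bounds (Finset.mem_Icc.1 hk).2
  have hs := (h.2 k hk).spec (h.prior_nonneg hk)
  refine ⟨h0, le_rfl, h1, fun S' hS hS' => ?_⟩
  -- The room left within the stage, prior minus increment, is exactly `Σ_k - S k`.
  have := hs.2.2.2 i (S' - S k) (sub_nonneg.2 hS) (by simpa using hS')
  rw [mul_sub, Matrix.trace_sub] at this
  linarith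

/-- The increments of greedy posteriors, with projections supported on the range of the prior
covariance. -/
lemma IsGreedy.exists_projection (h : G.IsGreedy σ S) :
    ∃ P : ℕ → Matrix (Fin p) (Fin p) ℝ, ∀ k ∈ Finset.Icc 1 G.n,
      (P k)ᵀ = P k ∧ P k * P k = P k ∧
      P k * (invSqrt (G.stateCov k - G.A * S (k - 1) * G.Aᵀ) *
        CFC.sqrt (G.stateCov k - G.A * S (k - 1) * G.Aᵀ)) = P k ∧
      S k = G.A * S (k - 1) * G.Aᵀ +
        CFC.sqrt (G.stateCov k - G.A * S (k - 1) * G.Aᵀ) * P k *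
          CFC.sqrt (G.stateCov k - G.A * S (k - 1) * G.Aᵀ) := by
  refine ⟨fun k => invSqrt (G.stateCov k - G.A * S (k - 1) * G.Aᵀ) *
    (S k - G.A * S (k - 1) * G.Aᵀ) * invSqrt (G.stateCov k - G.A * S (k - 1) * G.Aᵀ),
    fun k hk => ?_⟩
  have hM := h.prior_nonneg hk
  obtain ⟨h0, h1, h2, -⟩ := (h.2 k hk).spec hM
  refine ⟨?_, h2, ?_, ?_⟩
  · rw [Matrix.transpose_mul, Matrix.transpose_mul, invSqrt_transpose,
      transpose_eq_of_nonneg h0]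
    exact (mul_assoc _ _ _).symm
  · rw [← sqrt_mul_invSqrt_comm hM, mul_assoc, ← mul_assoc (invSqrt _) (CFC.sqrt _),
      invSqrt_mul_sqrt_mul_invSqrt hM]
  · rw [sqrt_conj_invSqrt_conj hM h0 h1]
    abel

end SignalingGame

/-! ### Second moments of random vectors -/

section CrossMoment

variable {Ω : Type*} [MeasurableSpace Ω] {μ : Measure Ω} {a b c : ℕ}
  {X X' : Ω → EuclideanSpace ℝ (Fin a)} {Y Y' : Ω → EuclideanSpace ℝ (Fin b)}

/-- The matrix `E[X Yᵀ]`. -/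
noncomputable def crossMoment (μ : Measure Ω) (X : Ω → EuclideanSpace ℝ (Fin a))
    (Y : Ω → EuclideanSpace ℝ (Fin b)) : Matrix (Fin a) (Fin b) ℝ :=
  Matrix.of fun i j => ∫ ω, X ω i * Y ω j ∂μ

lemma memLp_coord (hX : MemLp X 2 μ) (i : Fin a) : MemLp (fun ω => X ω i) 2 μ :=
  (EuclideanSpace.proj i : EuclideanSpace ℝ (Fin a) →L[ℝ] ℝ).comp_memLp' hX

lemma memLp_toEuclideanLin (hX : MemLp X 2 μ) (C : Matrix (Fin c) (Fin a) ℝ) :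
    MemLp (fun ω => Matrix.toEuclideanLin C (X ω)) 2 μ :=
  (LinearMap.toContinuousLinearMap (Matrix.toEuclideanLin C)).comp_memLp' hX

lemma measurable_toEuclideanLin (C : Matrix (Fin c) (Fin a) ℝ) :
    Measurable (Matrix.toEuclideanLin C) :=
  (LinearMap.toContinuousLinearMap (Matrix.toEuclideanLin C)).continuous.measurable

lemma integrable_coord_mul (hX : MemLp X 2 μ) (hY : MemLp Y 2 μ) (i : Fin a) (j : Fin b) :
    Integrable (fun ω => X ω i * Y ω j) μ :=
  (memLp_coord hX i).integrable_mul (memLp_coord hY j)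

lemma crossMoment_transpose : (crossMoment μ X Y)ᵀ = crossMoment μ Y X := by
  ext i j
  simp [crossMoment, mul_comm]

lemma crossMoment_congr_left (h : X =ᵐ[μ] X') : crossMoment μ X Y = crossMoment μ X' Y := by
  ext i j
  refine integral_congr_ae ?_
  filter_upwards [h] with ω hω
  simp only [hω]

lemma crossMoment_congr_right (h : Y =ᵐ[μ] Y') : crossMoment μ X Y = crossMoment μ X Y' := by
  rw [← crossMoment_transpose, crossMoment_congr_left h, crossMoment_transpose]

lemma crossMoment_add_left (hX : MemLp X 2 μ) (hX' : MemLp X' 2 μ) (hY : MemLp Y 2 μ) :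
    crossMoment μ (fun ω => X ω + X' ω) Y = crossMoment μ X Y + crossMoment μ X' Y := by
  ext i j
  simp only [crossMoment, Matrix.of_apply, Matrix.add_apply, PiLp.add_apply, add_mul]
  exact integral_add (integrable_coord_mul hX hY i j) (integrable_coord_mul hX' hY i j)

lemma crossMoment_sub_left (hX : MemLp X 2 μ) (hX' : MemLp X' 2 μ) (hY : MemLp Y 2 μ) :
    crossMoment μ (fun ω => X ω - X' ω) Y = crossMoment μ X Y - crossMoment μ X' Y := by
  ext i j
  simp only [crossMoment, Matrix.of_apply, Matrix.sub_apply, PiLp.sub_apply, sub_mul]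
  exact integral_sub (integrable_coord_mul hX hY i j) (integrable_coord_mul hX' hY i j)

lemma crossMoment_add_right (hX : MemLp X 2 μ) (hY : MemLp Y 2 μ) (hY' : MemLp Y' 2 μ) :
    crossMoment μ X (fun ω => Y ω + Y' ω) = crossMoment μ X Y + crossMoment μ X Y' := by
  rw [← crossMoment_transpose, crossMoment_add_left hY hY' hX, Matrix.transpose_add,
    crossMoment_transpose, crossMoment_transpose]

lemma crossMoment_sub_right (hX : MemLp X 2 μ) (hY : MemLp Y 2 μ) (hY' : MemLp Y' 2 μ) :
    crossMoment μ X (fun ω => Y ω - Y' ω) = crossMoment μ X Y - crossMoment μ X Y' := by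
  rw [← crossMoment_transpose, crossMoment_sub_left hY hY' hX, Matrix.transpose_sub,
    crossMoment_transpose, crossMoment_transpose]

lemma crossMoment_lin_left (hX : MemLp X 2 μ) (hY : MemLp Y 2 μ)
    (C : Matrix (Fin c) (Fin a) ℝ) :
    crossMoment μ (fun ω => Matrix.toEuclideanLin C (X ω)) Y = C * crossMoment μ X Y := by
  ext i j
  simp only [crossMoment, Matrix.of_apply, Matrix.mul_apply, Matrix.toLpLin_apply,
    Matrix.mulVec, dotProduct, Finset.sum_mul]
  rw [integral_finsetSum _ fun l _ => ?_]
  · refine Finset.sum_congr rfl fun l _ => ?_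
    rw [← integral_const_mul]
    simp only [mul_assoc]
  · simpa only [mul_assoc] using (integrable_coord_mul hX hY l j).const_mul (C i l)

lemma crossMoment_lin_right (hX : MemLp X 2 μ) (hY : MemLp Y 2 μ)
    (C : Matrix (Fin c) (Fin b) ℝ) :
    crossMoment μ X (fun ω => Matrix.toEuclideanLin C (Y ω)) = crossMoment μ X Y * Cᵀ := by
  rw [← crossMoment_transpose, crossMoment_lin_left hY hX, Matrix.transpose_mul,
    crossMoment_transpose]

lemma trace_crossMoment_self (hX : MemLp X 2 μ) :
    (crossMoment μ X X).trace = ∫ ω, ‖X ω‖ ^ 2 ∂μ := by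
  simp only [Matrix.trace, Matrix.diag_apply, crossMoment, Matrix.of_apply]
  rw [← integral_finsetSum _ fun i _ => integrable_coord_mul hX hX i i]
  refine integral_congr_ae (ae_of_all _ fun ω => ?_)
  simp [EuclideanSpace.norm_sq_eq (X ω), ← pow_two]

/-- `vᵀ E[X Xᵀ] v = E[(vᵀ X)²]`, with `vᵀ` written as a matrix with one row. -/
lemma crossMoment_self_nonneg (hX : MemLp X 2 μ) : 0 ≤ crossMoment μ X X := by
  rw [Matrix.nonneg_iff_posSemidef]
  refine Matrix.PosSemidef.of_dotProduct_mulVec_nonneg ?_ fun v => ?_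
  · simpa [Matrix.IsHermitian] using crossMoment_transpose (μ := μ) (X := X) (Y := X)
  · have h := crossMoment_lin_left hX (memLp_toEuclideanLin hX (Matrix.replicateRow (Fin 1) v))
      (Matrix.replicateRow (Fin 1) v)
    rw [crossMoment_lin_right hX hX] at h
    have h2 := congrFun (congrFun h 0) 0
    have h3 : 0 ≤ crossMoment μ
        (fun ω => Matrix.toEuclideanLin (Matrix.replicateRow (Fin 1) v) (X ω))
        (fun ω => Matrix.toEuclideanLin (Matrix.replicateRow (Fin 1) v) (X ω)) 0 0 :=
      integral_nonneg fun ω => mul_self_nonneg _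
    rw [h2] at h3
    refine h3.trans_eq ?_
    simp [Matrix.mul_apply, Matrix.mulVec, dotProduct, Matrix.replicateRow]

/-- If `E[X Yᵀ] = E[Y Yᵀ]`, then `E[Y Yᵀ] ≤ E[X Xᵀ]`. -/
lemma crossMoment_le_of_orthogonal {Y : Ω → EuclideanSpace ℝ (Fin a)} (hX : MemLp X 2 μ)
    (hY : MemLp Y 2 μ) (h : crossMoment μ X Y = crossMoment μ Y Y) :
    crossMoment μ Y Y ≤ crossMoment μ X X := by
  have h' : crossMoment μ Y X = crossMoment μ Y Y := by
    rw [← crossMoment_transpose, h, crossMoment_transpose]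
  have := crossMoment_self_nonneg (hX.sub hY)
  have e : crossMoment μ (X - Y) (X - Y) = crossMoment μ X X - crossMoment μ Y Y := by
    have := crossMoment_sub_left hX hY (hX.sub hY)
    rw [show (X - Y) = fun ω => X ω - Y ω from rfl] at this ⊢
    rw [this, crossMoment_sub_right hX hX hY, crossMoment_sub_right hY hX hY, h, h']
    abel
  rw [e] at this
  exact sub_nonneg.1 this

/-- Orthogonality of the conditional expectation. -/
lemma crossMoment_condExp {Ω : Type*} {m mΩ : MeasurableSpace Ω} {μ : Measure Ω} {a b : ℕ}
    {X : Ω → EuclideanSpace ℝ (Fin a)} {Y : Ω → EuclideanSpace ℝ (Fin b)} [IsFiniteMeasure μ]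
    (hm : m ≤ mΩ)
    (hX : MemLp X 2 μ) (hY : MemLp Y 2 μ) (hYm : StronglyMeasurable[m] Y) :
    crossMoment μ (μ[X | m]) Y = crossMoment μ X Y := by
  ext i j
  have hXi : Integrable X μ := hX.integrable (by norm_num)
  have h1 := (EuclideanSpace.proj i : EuclideanSpace ℝ (Fin a) →L[ℝ] ℝ).comp_condExp_comm
    (m := m) hXi
  have h2 : μ[(fun ω => X ω i * Y ω j) | m] =ᵐ[μ] fun ω => μ[X | m] ω i * Y ω j := by
    have hYj : StronglyMeasurable[m] (fun ω => Y ω j) :=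
      (EuclideanSpace.proj j : EuclideanSpace ℝ (Fin b) →L[ℝ] ℝ).continuous.comp_stronglyMeasurable
        hYm
    refine (condExp_mul_of_stronglyMeasurable_right hYj (integrable_coord_mul hX hY i j)
      ((memLp_coord hX i).integrable (by norm_num))).trans ?_
    filter_upwards [h1] with ω hω
    have : (μ[X | m]) ω i = μ[fun ω => X ω i | m] ω := hω
    rw [Pi.mul_apply, this]
  simp only [crossMoment, Matrix.of_apply]
  rw [← integral_congr_ae h2, integral_condExp hm]

end CrossMoment

/-! ### Conditional estimates and posterior covariances -/

section Estimates

variable {Ω : Type*} [mΩ : MeasurableSpace Ω] {μ : Measure Ω} {m p : ℕ}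
  {x : ℕ → Ω → EuclideanSpace ℝ (Fin p)} {η η' : SenderProfile m p} {k : ℕ}

lemma measurable_messages (hx : ∀ l ≤ k, Measurable (x l)) : Measurable (messages x η k) := by
  refine measurable_pi_lambda _ fun j => measurable_pi_lambda _ fun i => ?_
  exact (η i (j + 1)).2.comp (measurable_pi_lambda _ fun l => hx _ (by omega))

/-- Doob–Dynkin factorization; it makes the estimate available to a Borel receiver policy. -/
lemma exists_estimate_eq_comp (μ : Measure Ω) (x : ℕ → Ω → EuclideanSpace ℝ (Fin p))
    (η : SenderProfile m p) (k : ℕ) :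
    ∃ f : (Fin k → Fin m → EuclideanSpace ℝ (Fin p)) → EuclideanSpace ℝ (Fin p),
      Measurable f ∧ estimate μ x η k = f ∘ messages x η k := by
  obtain ⟨f, hf, he⟩ := (stronglyMeasurable_condExp (μ := μ) (f := x k)
    (m := MeasurableSpace.comap (messages x η k) inferInstance)).exists_eq_measurable_comp
  exact ⟨f, hf.measurable, he⟩

lemma memLp_estimate (hx : MemLp (x k) 2 μ) : MemLp (estimate μ x η k) 2 μ :=
  hx.condExp (by norm_num)

lemma crossMoment_estimate [IsFiniteMeasure μ] {b : ℕ} {Y : Ω → EuclideanSpace ℝ (Fin b)}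
    (hm : ∀ l ≤ k, Measurable (x l)) (hx : MemLp (x k) 2 μ) (hY : MemLp Y 2 μ)
    (hYm : Measurable[MeasurableSpace.comap (messages x η k) inferInstance] Y) :
    crossMoment μ (estimate μ x η k) Y = crossMoment μ (x k) Y :=
  crossMoment_condExp (measurable_messages hm).comap_le hx hY hYm.stronglyMeasurable

lemma measurable_estimate :
    Measurable[MeasurableSpace.comap (messages x η k) inferInstance] (estimate μ x η k) :=
  stronglyMeasurable_condExp.measurable

lemma posteriorCov_eq : posteriorCov μ x η k =
    crossMoment μ (estimate μ x η k) (estimate μ x η k) := rfl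

lemma crossMoment_state_estimate [IsFiniteMeasure μ] (hm : ∀ l ≤ k, Measurable (x l))
    (hx : MemLp (x k) 2 μ) : crossMoment μ (x k) (estimate μ x η k) = posteriorCov μ x η k :=
  (crossMoment_estimate hm hx (memLp_estimate hx) measurable_estimate).symm

lemma posteriorCov_le [IsFiniteMeasure μ] (hm : ∀ l ≤ k, Measurable (x l))
    (hx : MemLp (x k) 2 μ) : posteriorCov μ x η k ≤ crossMoment μ (x k) (x k) :=
  crossMoment_le_of_orthogonal hx (memLp_estimate hx) (crossMoment_state_estimate hm hx)

/-- More information gives a larger posterior covariance. -/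
lemma posteriorCov_mono [IsFiniteMeasure μ] (hm : ∀ l ≤ k, Measurable (x l))
    (hx : MemLp (x k) 2 μ)
    (hle : MeasurableSpace.comap (messages x η k) inferInstance ≤
      MeasurableSpace.comap (messages x η' k) inferInstance) :
    posteriorCov μ x η k ≤ posteriorCov μ x η' k := by
  refine crossMoment_le_of_orthogonal (memLp_estimate hx) (memLp_estimate hx) ?_
  -- The coarser estimate is measurable for the finer information, so its moment with the finer
  -- estimate equals its moment with the state.
  rw [crossMoment_estimate hm hx (memLp_estimate hx) (measurable_estimate.mono hle le_rfl),
    crossMoment_state_estimate hm hx]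
  rfl

lemma memLp_of_lintegral_sq_ne_top {a : ℕ} {Y : Ω → EuclideanSpace ℝ (Fin a)}
    (hY : AEStronglyMeasurable Y μ) (h : ∫⁻ ω, ENNReal.ofReal (‖Y ω‖ ^ 2) ∂μ ≠ ⊤) :
    MemLp Y 2 μ := by
  rw [memLp_two_iff_integrable_sq_norm hY]
  refine ⟨(hY.norm.pow 2), ?_⟩
  rw [hasFiniteIntegral_iff_ofReal (ae_of_all _ fun ω => by positivity)]
  exact h.lt_top

lemma lintegral_sq_eq {a : ℕ} {Y : Ω → EuclideanSpace ℝ (Fin a)} (hY : MemLp Y 2 μ) :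
    ∫⁻ ω, ENNReal.ofReal (‖Y ω‖ ^ 2) ∂μ = ENNReal.ofReal (crossMoment μ Y Y).trace := by
  rw [trace_crossMoment_self hY]
  exact (ofReal_integral_eq_lintegral_ofReal
    ((memLp_two_iff_integrable_sq_norm hY.1).1 hY) (ae_of_all _ fun ω => by positivity)).symm

end Estimates

lemma toEuclideanLin_mul_apply {a b c : ℕ} (C : Matrix (Fin a) (Fin b) ℝ)
    (D : Matrix (Fin b) (Fin c) ℝ) (v : EuclideanSpace ℝ (Fin c)) :
    Matrix.toEuclideanLin (C * D) v = Matrix.toEuclideanLin C (Matrix.toEuclideanLin D v) := by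
  simp [Matrix.toLpLin_apply, Matrix.mulVec_mulVec]

lemma toEuclideanLin_one_apply {a : ℕ} (v : EuclideanSpace ℝ (Fin a)) :
    Matrix.toEuclideanLin (1 : Matrix (Fin a) (Fin a) ℝ) v = v := by
  simp

/-! ### Best response of the receiver and the resulting sender costs -/

namespace SignalingGame

variable {m p t q : ℕ} (G : SignalingGame m p t q)
variable {Ω : Type*} [mΩ : MeasurableSpace Ω] {μ : Measure Ω}
  {x : ℕ → Ω → EuclideanSpace ℝ (Fin p)} {η η' : SenderProfile m p}

/-- The matrix `(RᵀR)⁻¹ Rᵀ Q` of the receiver: its best response to an estimate `v` of the state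
is minus the image of `v`. -/
noncomputable def gain (k : ℕ) : Matrix (Fin t) (Fin p) ℝ :=
  ((G.R none k)ᵀ * G.R none k)⁻¹ * (G.R none k)ᵀ * G.Q none k

/-- Expected cost of player `j` at stage `k`. -/
noncomputable def stageCost (μ : Measure Ω) (x : ℕ → Ω → EuclideanSpace ℝ (Fin p))
    (j : Option (Fin m)) (k : ℕ) (u : Ω → EuclideanSpace ℝ (Fin t)) : ENNReal :=
  ∫⁻ ω, ENNReal.ofReal
    (‖Matrix.toEuclideanLin (G.Q j k) (x k ω) + Matrix.toEuclideanLin (G.R j k) (u ω)‖ ^ 2) ∂μ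

/-- `γ` responds to the profile `η` with the linear rule in the estimate. -/
def RespondsTo (μ : Measure Ω) (x : ℕ → Ω → EuclideanSpace ℝ (Fin p)) (η : SenderProfile m p)
    (g : ReceiverPolicy m p t) : Prop :=
  ∀ k ω, (g k).1 (messages x η k ω) = -Matrix.toEuclideanLin (G.gain k) (estimate μ x η k ω)

lemma exists_respondsTo (μ : Measure Ω) (x : ℕ → Ω → EuclideanSpace ℝ (Fin p))
    (η : SenderProfile m p) : ∃ g : ReceiverPolicy m p t, G.RespondsTo μ x η g := by
  choose f hf he using exists_estimate_eq_comp μ x η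
  refine ⟨fun k => ⟨fun y => -Matrix.toEuclideanLin (G.gain k) (f k y),
    ((measurable_toEuclideanLin _).comp (hf k)).neg⟩, fun k ω => ?_⟩
  simp [he k]

variable {G}

lemma cost_eq_sum_stageCost (hm : ∀ l ≤ G.n, Measurable (x l)) (j : Option (Fin m))
    {s : Finset ℕ} (hs : ∀ k ∈ s, k ≤ G.n) (η : SenderProfile m p) (g : ReceiverPolicy m p t) :
    G.cost μ x j s η g =
      ∑ k ∈ s, G.stageCost μ x j k (fun ω => (g k).1 (messages x η k ω)) := by
  refine lintegral_finsetSum' _ fun k hk => Measurable.aemeasurable ?_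
  have h1 : Measurable (messages x η k) := measurable_messages fun l hl => hm l (hl.trans (hs k hk))
  exact ((((measurable_toEuclideanLin _).comp (hm k (hs k hk))).add
    ((measurable_toEuclideanLin _).comp ((g k).2.comp h1))).norm.pow_const 2).ennreal_ofReal

/-- Completing the square: another policy differs from the linear rule by a function `d` of the
messages. The normal equation removes the cross terms, and the cost increases by `E‖R d‖²`. -/
lemma RespondsTo.stageCost_le [IsFiniteMeasure μ] {k : ℕ} (hk : k ∈ Finset.Icc 1 G.n)
    (hm : ∀ l ≤ k, Measurable (x l)) (hx : MemLp (x k) 2 μ) {g₀ : ReceiverPolicy m p t}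
    (h : G.RespondsTo μ x η g₀) (g : ReceiverPolicy m p t) :
    G.stageCost μ x none k (fun ω => (g₀ k).1 (messages x η k ω)) ≤
      G.stageCost μ x none k (fun ω => (g k).1 (messages x η k ω)) := by
  -- Only a finite cost makes the competing action square integrable, as the expansion requires.
  by_cases htop : G.stageCost μ x none k (fun ω => (g k).1 (messages x η k ω)) = ⊤
  · rw [htop]; exact le_top
  set R := G.R none k with hR
  set Q := G.Q none k with hQ
  have hU : IsUnit (Rᵀ * R).det := (Matrix.isUnit_iff_isUnit_det _).1 (G.isUnit_receiver k hk)
  have hmes : Measurable (messages x η k) := measurable_messages hm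
  set u : Ω → EuclideanSpace ℝ (Fin t) := fun ω => (g k).1 (messages x η k ω) with hu
  set v : Ω → EuclideanSpace ℝ (Fin t) := fun ω => (g₀ k).1 (messages x η k ω) with hv
  have hvL : MemLp v 2 μ := by
    have : v = fun ω => -Matrix.toEuclideanLin (G.gain k) (estimate μ x η k ω) := funext (h k)
    rw [this]
    exact (memLp_toEuclideanLin (memLp_estimate hx) _).neg
  have hum : Measurable u := (g k).2.comp hmes
  have hQx := memLp_toEuclideanLin hx Q
  have hsum : MemLp (fun ω => Matrix.toEuclideanLin Q (x k ω) + Matrix.toEuclideanLin R (u ω))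
      2 μ := by
    refine memLp_of_lintegral_sq_ne_top ?_ htop
    exact (((measurable_toEuclideanLin _).comp (hm k le_rfl)).add
      ((measurable_toEuclideanLin _).comp hum)).aestronglyMeasurable
  have hRu : MemLp (fun ω => Matrix.toEuclideanLin R (u ω)) 2 μ := by
    have e : (fun ω => Matrix.toEuclideanLin R (u ω)) =
        (fun ω => Matrix.toEuclideanLin Q (x k ω) + Matrix.toEuclideanLin R (u ω)) -
          fun ω => Matrix.toEuclideanLin Q (x k ω) := by
      ext1 ω
      simp only [Pi.sub_apply, add_sub_cancel_left]
    rw [e]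
    exact hsum.sub hQx
  -- `(RᵀR)⁻¹Rᵀ` is a left inverse of `R`, so integrability passes from `R u` to `u`.
  have huL : MemLp u 2 μ := by
    have := memLp_toEuclideanLin hRu ((Rᵀ * R)⁻¹ * Rᵀ)
    convert this using 2 with ω
    rw [← toEuclideanLin_mul_apply, Matrix.mul_assoc, Matrix.nonsing_inv_mul _ hU,
      toEuclideanLin_one_apply]
  set d : Ω → EuclideanSpace ℝ (Fin t) := fun ω => u ω - v ω with hd
  have hdL : MemLp d 2 μ := huL.sub hvL
  have hdm : Measurable[MeasurableSpace.comap (messages x η k) inferInstance] d :=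
    ((g k).2.comp (comap_measurable _)).sub ((g₀ k).2.comp (comap_measurable _))
  set c : Ω → EuclideanSpace ℝ (Fin q) :=
    fun ω => Matrix.toEuclideanLin Q (x k ω) + Matrix.toEuclideanLin R (v ω) with hc
  have hcL : MemLp c 2 μ := hQx.add (memLp_toEuclideanLin hvL R)
  have hRd := memLp_toEuclideanLin hdL R
  have hsplit : (fun ω => Matrix.toEuclideanLin Q (x k ω) + Matrix.toEuclideanLin R (u ω)) =
      fun ω => c ω + Matrix.toEuclideanLin R (d ω) := by
    ext1 ω
    simp [hc, hd]
  have hRv : (fun ω => Matrix.toEuclideanLin (Rᵀ) (Matrix.toEuclideanLin R (v ω))) =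
      fun ω => -Matrix.toEuclideanLin (Rᵀ * Q) (estimate μ x η k ω) := by
    ext1 ω
    rw [show v ω = _ from h k ω, map_neg, map_neg, ← toEuclideanLin_mul_apply,
      ← toEuclideanLin_mul_apply, gain, ← hR, ← hQ, Matrix.mul_assoc _ Rᵀ Q,
      ← Matrix.mul_assoc (Rᵀ * R), Matrix.mul_nonsing_inv _ hU, Matrix.one_mul]
  have hcross : Rᵀ * crossMoment μ c d = 0 := by
    rw [← crossMoment_lin_left hcL hdL]
    have : (fun ω => Matrix.toEuclideanLin (Rᵀ) (c ω)) = fun ω =>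
        Matrix.toEuclideanLin (Rᵀ * Q) (x k ω) -
          Matrix.toEuclideanLin (Rᵀ * Q) (estimate μ x η k ω) := by
      ext1 ω
      rw [hc]
      simp only [map_add]
      rw [show Matrix.toEuclideanLin (Rᵀ) (Matrix.toEuclideanLin R (v ω)) = _ from
        congrFun hRv ω, ← toEuclideanLin_mul_apply, sub_eq_add_neg]
    rw [this, crossMoment_sub_left (memLp_toEuclideanLin hx _)
      (memLp_toEuclideanLin (memLp_estimate hx) _) hdL, crossMoment_lin_left hx hdL,
      crossMoment_lin_left (memLp_estimate hx) hdL, crossMoment_estimate hm hx hdL hdm, sub_self]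
  have htr : (crossMoment μ c d * Rᵀ).trace = 0 := by
    rw [Matrix.trace_mul_comm, hcross, Matrix.trace_zero]
  have htr' : (R * crossMoment μ d c).trace = 0 := by
    rw [← Matrix.trace_transpose, Matrix.transpose_mul, crossMoment_transpose, htr]
  have hcRd : MemLp (fun ω => c ω + Matrix.toEuclideanLin R (d ω)) 2 μ := hcL.add hRd
  have hcost : G.stageCost μ x none k u =
      ENNReal.ofReal (crossMoment μ (fun ω => c ω + Matrix.toEuclideanLin R (d ω))
        (fun ω => c ω + Matrix.toEuclideanLin R (d ω))).trace := by
    rw [← lintegral_sq_eq hcRd]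
    exact lintegral_congr fun ω =>
      congrArg (fun z => ENNReal.ofReal (‖z‖ ^ 2)) (congrFun hsplit ω)
  rw [hcost, stageCost, lintegral_sq_eq hcL]
  refine ENNReal.ofReal_le_ofReal ?_
  have hfin := trace_nonneg_of_nonneg (crossMoment_self_nonneg hRd)
  have e : crossMoment μ (fun ω => c ω + Matrix.toEuclideanLin R (d ω))
      (fun ω => c ω + Matrix.toEuclideanLin R (d ω)) = crossMoment μ c c + crossMoment μ c d * Rᵀ +
      (R * crossMoment μ d c + crossMoment μ (fun ω => Matrix.toEuclideanLin R (d ω))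
        (fun ω => Matrix.toEuclideanLin R (d ω))) := by
    rw [crossMoment_add_left hcL hRd hcRd, crossMoment_add_right hcL hcL hRd,
      crossMoment_add_right hRd hcL hRd, crossMoment_lin_right hcL hdL,
      crossMoment_lin_left hdL hcL]
  rw [e, Matrix.trace_add, Matrix.trace_add, Matrix.trace_add, htr, htr']
  linarith

/-- Expand `E‖Q x - Λ x̂‖²`: since `E[x x̂ᵀ] = E[x̂ x̂ᵀ]`, everything that depends on the profile
collects into `Tr(V S)`. -/
lemma RespondsTo.stageCost_sender [IsFiniteMeasure μ] {k : ℕ}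
    (hm : ∀ l ≤ k, Measurable (x l)) (hx : MemLp (x k) 2 μ) {g : ReceiverPolicy m p t}
    (h : G.RespondsTo μ x η g) (i : Fin m) :
    G.stageCost μ x (some i) k (fun ω => (g k).1 (messages x η k ω)) =
      ENNReal.ofReal ((G.Q (some i) k * crossMoment μ (x k) (x k) * (G.Q (some i) k)ᵀ).trace +
        (G.V i k * posteriorCov μ x η k).trace) := by
  set Q := G.Q (some i) k with hQ
  set S := posteriorCov μ x η k with hS
  have hest := memLp_estimate (η := η) hx
  have hu : (fun ω => Matrix.toEuclideanLin Q (x k ω) +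
      Matrix.toEuclideanLin (G.R (some i) k) ((g k).1 (messages x η k ω))) =
      fun ω => Matrix.toEuclideanLin Q (x k ω) -
        Matrix.toEuclideanLin (G.lam i k) (estimate μ x η k ω) := by
    ext1 ω
    rw [h k ω, map_neg, ← toEuclideanLin_mul_apply, sub_eq_add_neg]
    simp only [gain, lam, Matrix.mul_assoc]
  have hQx := memLp_toEuclideanLin hx Q
  have hLx := memLp_toEuclideanLin hest (G.lam i k)
  have h1 : crossMoment μ (x k) (estimate μ x η k) = S := crossMoment_state_estimate hm hx
  have h2 : crossMoment μ (estimate μ x η k) (x k) = S := by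
    rw [← crossMoment_transpose, h1, hS, posteriorCov_eq, crossMoment_transpose]
  have h3 : crossMoment μ (estimate μ x η k) (estimate μ x η k) = S := rfl
  have hsub : MemLp (fun ω => Matrix.toEuclideanLin Q (x k ω) -
      Matrix.toEuclideanLin (G.lam i k) (estimate μ x η k ω)) 2 μ := hQx.sub hLx
  have hcost : G.stageCost μ x (some i) k (fun ω => (g k).1 (messages x η k ω)) =
      ENNReal.ofReal (crossMoment μ (fun ω => Matrix.toEuclideanLin Q (x k ω) -
        Matrix.toEuclideanLin (G.lam i k) (estimate μ x η k ω)) (fun ω =>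
        Matrix.toEuclideanLin Q (x k ω) -
          Matrix.toEuclideanLin (G.lam i k) (estimate μ x η k ω))).trace := by
    rw [← lintegral_sq_eq hsub]
    exact lintegral_congr fun ω => congrArg (fun z => ENNReal.ofReal (‖z‖ ^ 2)) (congrFun hu ω)
  rw [hcost, crossMoment_sub_left hQx hLx hsub]
  have e1 := crossMoment_sub_right hQx hQx hLx
  have e2 := crossMoment_sub_right hLx hQx hLx
  rw [e1, e2, crossMoment_lin_left hx hQx, crossMoment_lin_right hx hx,
    crossMoment_lin_left hx hLx, crossMoment_lin_right hx hest, crossMoment_lin_left hest hQx,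
    crossMoment_lin_right hest hx, crossMoment_lin_left hest hLx, crossMoment_lin_right hest hest,
    h1, h2, h3, V]
  congr 1
  have t1 : (Q * (S * (G.lam i k)ᵀ)).trace = ((G.lam i k)ᵀ * Q * S).trace := by
    rw [← Matrix.mul_assoc, Matrix.trace_mul_comm, Matrix.mul_assoc]
  have t2 : (G.lam i k * (S * Qᵀ)).trace = (Qᵀ * G.lam i k * S).trace := by
    rw [← Matrix.mul_assoc, Matrix.trace_mul_comm, Matrix.mul_assoc]
  have t3 : (G.lam i k * (S * (G.lam i k)ᵀ)).trace = ((G.lam i k)ᵀ * G.lam i k * S).trace := by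
    rw [← Matrix.mul_assoc, Matrix.trace_mul_comm, Matrix.mul_assoc]
  simp only [Matrix.trace_sub, sub_mul, t1, t2, t3, ← hQ, Matrix.mul_assoc]
  simp only [← Matrix.mul_assoc]
  ring

end SignalingGame

/-! ### Linear functions of a Gaussian vector -/

section LinearFunctions

variable {Ω F E E' : Type*} [NormedAddCommGroup F] [NormedSpace ℝ F]
  [NormedAddCommGroup E] [NormedSpace ℝ E] [NormedAddCommGroup E'] [NormedSpace ℝ E']

/-- `X` is a continuous linear function of `Z`. -/
def IsLinearIn (Z : Ω → F) (X : Ω → E) : Prop :=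
  ∃ L : F →L[ℝ] E, ∀ ω, X ω = L (Z ω)

variable {Z : Ω → F} {X X' : Ω → E} {Y : Ω → E'}

lemma isLinearIn_zero : IsLinearIn Z (fun _ => (0 : E)) := ⟨0, fun _ => rfl⟩

lemma IsLinearIn.add (h : IsLinearIn Z X) (h' : IsLinearIn Z X') :
    IsLinearIn Z (fun ω => X ω + X' ω) := by
  obtain ⟨L, hL⟩ := h
  obtain ⟨L', hL'⟩ := h'
  exact ⟨L + L', fun ω => by simp [hL, hL']⟩

lemma IsLinearIn.sub (h : IsLinearIn Z X) (h' : IsLinearIn Z X') :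
    IsLinearIn Z (fun ω => X ω - X' ω) := by
  obtain ⟨L, hL⟩ := h
  obtain ⟨L', hL'⟩ := h'
  exact ⟨L - L', fun ω => by simp [hL, hL']⟩

lemma IsLinearIn.clm (h : IsLinearIn Z X) (C : E →L[ℝ] E') : IsLinearIn Z (fun ω => C (X ω)) := by
  obtain ⟨L, hL⟩ := h
  exact ⟨C.comp L, fun ω => by simp [hL]⟩

lemma IsLinearIn.toEuclideanLin {a b : ℕ} {X : Ω → EuclideanSpace ℝ (Fin a)}
    (h : IsLinearIn Z X) (C : Matrix (Fin b) (Fin a) ℝ) :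
    IsLinearIn Z (fun ω => Matrix.toEuclideanLin C (X ω)) :=
  h.clm (LinearMap.toContinuousLinearMap (Matrix.toEuclideanLin C))

lemma IsLinearIn.coord {a : ℕ} {X : Ω → EuclideanSpace ℝ (Fin a)}
    (h : IsLinearIn Z X) (i : Fin a) : IsLinearIn Z (fun ω => X ω i) :=
  h.clm (EuclideanSpace.proj i : EuclideanSpace ℝ (Fin a) →L[ℝ] ℝ)

lemma IsLinearIn.prodMk (h : IsLinearIn Z X) (h' : IsLinearIn Z Y) :
    IsLinearIn Z (fun ω => (X ω, Y ω)) := by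
  obtain ⟨L, hL⟩ := h
  obtain ⟨L', hL'⟩ := h'
  exact ⟨L.prod L', fun ω => by simp [hL, hL']⟩

lemma IsLinearIn.pi {ι : Type*} [Fintype ι] {X : ι → Ω → E} (h : ∀ i, IsLinearIn Z (X i)) :
    IsLinearIn Z (fun ω i => X i ω) := by
  choose L hL using h
  exact ⟨ContinuousLinearMap.pi L, fun ω => by ext i; simp [hL]⟩

variable [MeasurableSpace Ω] {μ : Measure Ω}

lemma IsLinearIn.integral_eq_zero [CompleteSpace F] [CompleteSpace E] (h : IsLinearIn Z X)
    (hZ : Integrable Z μ) (h0 : ∫ ω, Z ω ∂μ = 0) : ∫ ω, X ω ∂μ = 0 := by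
  obtain ⟨L, hL⟩ := h
  simp_rw [hL]
  rw [L.integral_comp_comm hZ, h0, map_zero]

variable [MeasurableSpace F] [BorelSpace F]

lemma IsLinearIn.measurable [MeasurableSpace E] [BorelSpace E] (h : IsLinearIn Z X)
    (hZ : Measurable Z) : Measurable X := by
  obtain ⟨L, hL⟩ := h
  rw [show X = L ∘ Z from funext hL]
  exact L.continuous.measurable.comp hZ

lemma IsLinearIn.hasGaussianLaw [MeasurableSpace E] [BorelSpace E] (h : IsLinearIn Z X)
    (hZ : HasGaussianLaw Z μ) : HasGaussianLaw X μ := by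
  obtain ⟨L, hL⟩ := h
  rw [show X = L ∘ Z from funext hL]
  exact hZ.map L

/-- Uncorrelated centered linear functions of a Gaussian vector are independent, so that the
conditional expectation of one given the other vanishes. -/
lemma condExp_eq_zero_of_crossMoment_eq_zero [CompleteSpace F] [SecondCountableTopology F]
    {m p k : ℕ} {ε : Ω → EuclideanSpace ℝ (Fin p)}
    {W : Ω → Fin k → Fin m → EuclideanSpace ℝ (Fin p)}
    (hZ : HasGaussianLaw Z μ) (hZm : Measurable Z) (h0 : ∫ ω, Z ω ∂μ = 0) (hε : IsLinearIn Z ε)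
    (hW : ∀ j i, IsLinearIn Z (fun ω => W ω j i))
    (h : ∀ j i, crossMoment μ ε (fun ω => W ω j i) = 0) :
    μ[ε | MeasurableSpace.comap W inferInstance] =ᵐ[μ] 0 := by
  have := hZ.isProbabilityMeasure
  have hZi := hZ.integrable
  -- Both vectors are flattened into real coordinates, where joint Gaussianity and vanishing
  -- covariances give independence.
  let X' : Fin p → Ω → ℝ := fun a ω => ε ω a
  let W' : Fin k × Fin m × Fin p → Ω → ℝ := fun c ω => W ω c.1 c.2.1 c.2.2
  have hX' : ∀ a, IsLinearIn Z (X' a) := fun a => hε.coord a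
  have hW' : ∀ c, IsLinearIn Z (W' c) := fun c => (hW c.1 c.2.1).coord c.2.2
  have hG : HasGaussianLaw (fun ω => (fun a => X' a ω, fun c => W' c ω)) μ :=
    ((IsLinearIn.pi hX').prodMk (IsLinearIn.pi hW')).hasGaussianLaw hZ
  have hind := hG.indepFun_of_covariance_eval fun a c => by
    rw [covariance_eq_sub ((hX' a).hasGaussianLaw hZ).memLp_two
      ((hW' c).hasGaussianLaw hZ).memLp_two, (hX' a).integral_eq_zero hZi h0, zero_mul, sub_zero]
    exact congrFun (congrFun (h c.1 c.2.1) a) c.2.2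
  have hind2 : IndepFun ε W μ := by
    have := hind.comp (φ := fun v : Fin p → ℝ => WithLp.toLp 2 v)
      (ψ := fun (v : Fin k × Fin m × Fin p → ℝ) (j : Fin k) (i : Fin m) =>
        WithLp.toLp 2 (fun a => v (j, i, a))) (by fun_prop) (by fun_prop)
    exact this
  have hεm := hε.measurable hZm
  have hWm : Measurable W :=
    measurable_pi_lambda _ fun j => measurable_pi_lambda _ fun i => (hW j i).measurable hZm
  have := condExp_indep_eq hεm.comap_le hWm.comap_le
    (f := ε) (comap_measurable ε).stronglyMeasurable hind2
  rw [hε.integral_eq_zero hZi h0] at this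
  exact this

end LinearFunctions

/-! ### Moments of the Gaussian primitives -/

section Gaussian

variable {Ω : Type*} [MeasurableSpace Ω] {μ : Measure Ω} {p : ℕ}

lemma hasGaussianLaw_of_map_eq {X : Ω → EuclideanSpace ℝ (Fin p)}
    {m : EuclideanSpace ℝ (Fin p)} {S : Matrix (Fin p) (Fin p) ℝ}
    (h : μ.map X = multivariateGaussian m S) : HasGaussianLaw X μ where
  isGaussian_map := by rw [h]; infer_instance

lemma integral_eq_zero_of_map_eq {X : Ω → EuclideanSpace ℝ (Fin p)} (hX : Measurable X)
    {S : Matrix (Fin p) (Fin p) ℝ} (h : μ.map X = multivariateGaussian 0 S) :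
    ∫ ω, X ω ∂μ = 0 := by
  rw [← integral_map (f := fun y => y) hX.aemeasurable (by fun_prop), h,
    integral_id_multivariateGaussian]

lemma integral_coord_eq_zero {X : Ω → EuclideanSpace ℝ (Fin p)} (hX : Integrable X μ)
    (h : ∫ ω, X ω ∂μ = 0) (i : Fin p) : ∫ ω, X ω i ∂μ = 0 := by
  have := (EuclideanSpace.proj i : EuclideanSpace ℝ (Fin p) →L[ℝ] ℝ).integral_comp_comm hX
  rw [h, map_zero] at this
  exact this

lemma crossMoment_of_map_eq {X : Ω → EuclideanSpace ℝ (Fin p)} (hX : Measurable X)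
    {S : Matrix (Fin p) (Fin p) ℝ} (hS : S.PosSemidef) (h : μ.map X = multivariateGaussian 0 S) :
    crossMoment μ X X = S := by
  ext i j
  have hG := hasGaussianLaw_of_map_eq h
  have := hG.isProbabilityMeasure
  have hL := hG.memLp_two
  have h1 := covariance_eval_multivariateGaussian (μ := 0) hS i j
  rw [← h, covariance_map (by fun_prop) (by fun_prop) hX.aemeasurable] at h1
  have h2 := integral_coord_eq_zero hG.integrable (integral_eq_zero_of_map_eq hX h) i
  have h3 := covariance_eq_sub (memLp_coord hL i) (memLp_coord hL j)
  rw [h2, zero_mul, sub_zero] at h3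
  exact h3.symm.trans h1

lemma crossMoment_of_indepFun {X Y : Ω → EuclideanSpace ℝ (Fin p)} (hX : MemLp X 2 μ)
    (hY : MemLp Y 2 μ) [IsFiniteMeasure μ] (h0 : ∫ ω, X ω ∂μ = 0) (h : IndepFun X Y μ) :
    crossMoment μ X Y = 0 := by
  ext i j
  have h1 : IndepFun (fun ω => X ω i) (fun ω => Y ω j) μ :=
    h.comp (φ := fun y : EuclideanSpace ℝ (Fin p) => y i)
      (ψ := fun y : EuclideanSpace ℝ (Fin p) => y j) (by fun_prop) (by fun_prop)
  have h2 := h1.integral_fun_mul_eq_mul_integral (memLp_coord hX i).1 (memLp_coord hY j).1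
  rw [integral_coord_eq_zero (hX.integrable (by norm_num)) h0, zero_mul] at h2
  exact h2

end Gaussian

/-! ### Linear filtering policies -/

section Filter

variable {p : ℕ} (A : Matrix (Fin p) (Fin p) ℝ) (Γ C : ℕ → Matrix (Fin p) (Fin p) ℝ)

/-- The estimates `z_0 = 0`, `z_{k+1} = A z_k + Γ_{k+1} (ξ_{k+1} - A z_k)`. -/
noncomputable def filterEst (ξ : ℕ → EuclideanSpace ℝ (Fin p)) : ℕ → EuclideanSpace ℝ (Fin p)
  | 0 => 0
  | k + 1 => Matrix.toEuclideanLin A (filterEst ξ k) +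
      Matrix.toEuclideanLin (Γ (k + 1)) (ξ (k + 1) - Matrix.toEuclideanLin A (filterEst ξ k))

/-- The message `C_k (ξ_k - A z_{k-1})` at stage `k`. -/
noncomputable def filterMsg (ξ : ℕ → EuclideanSpace ℝ (Fin p)) (k : ℕ) :
    EuclideanSpace ℝ (Fin p) :=
  Matrix.toEuclideanLin (C k) (ξ k - Matrix.toEuclideanLin A (filterEst A Γ ξ (k - 1)))

variable {A Γ C}

lemma filterEst_congr {ξ ξ' : ℕ → EuclideanSpace ℝ (Fin p)} {k : ℕ}
    (h : ∀ l, 1 ≤ l → l ≤ k → ξ l = ξ' l) : filterEst A Γ ξ k = filterEst A Γ ξ' k := by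
  induction k with
  | zero => rfl
  | succ k ih =>
    rw [filterEst, filterEst, ih fun l h1 h2 => h l h1 (by omega), h (k + 1) (by omega) le_rfl]

lemma filterMsg_congr {ξ ξ' : ℕ → EuclideanSpace ℝ (Fin p)} {k : ℕ} (hk : 1 ≤ k)
    (h : ∀ l, 1 ≤ l → l ≤ k → ξ l = ξ' l) : filterMsg A Γ C ξ k = filterMsg A Γ C ξ' k := by
  rw [filterMsg, filterMsg, filterEst_congr fun l h1 h2 => h l h1 (by omega), h k hk le_rfl]

variable {α : Type*} [MeasurableSpace α] {ξ : ℕ → α → EuclideanSpace ℝ (Fin p)}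

lemma measurable_filterEst (h : ∀ l, Measurable (ξ l)) (k : ℕ) :
    Measurable (fun f => filterEst A Γ (fun l => ξ l f) k) := by
  induction k with
  | zero => exact measurable_const
  | succ k ih =>
    exact ((measurable_toEuclideanLin _).comp ih).add ((measurable_toEuclideanLin _).comp
      ((h (k + 1)).sub ((measurable_toEuclideanLin _).comp ih)))

lemma measurable_filterMsg (h : ∀ l, Measurable (ξ l)) (k : ℕ) :
    Measurable (fun f => filterMsg A Γ C (fun l => ξ l f) k) :=
  (measurable_toEuclideanLin _).comp
    ((h k).sub ((measurable_toEuclideanLin _).comp (measurable_filterEst h (k - 1))))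

/-- Stage `l` is stored at index `l - 1`. The value produced at `l = 0` is irrelevant: at stages `k
≥ 1` the filter never reads `ξ 0`. -/
lemma measurable_extend (k l : ℕ) : Measurable
    (fun f : Fin k → EuclideanSpace ℝ (Fin p) => if h : l - 1 < k then f ⟨l - 1, h⟩ else 0) := by
  split_ifs
  · exact measurable_pi_apply _
  · exact measurable_const

variable (A Γ C) in
/-- The policy that sends the messages `filterMsg`. -/
noncomputable def filterPolicy : SenderPolicy p := fun k =>
  ⟨fun f => filterMsg A Γ C (fun l => if h : l - 1 < k then f ⟨l - 1, h⟩ else 0) k,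
    measurable_filterMsg (measurable_extend k) k⟩

lemma filterPolicy_apply {ξ : ℕ → EuclideanSpace ℝ (Fin p)} {k : ℕ} (hk : 1 ≤ k) :
    (filterPolicy A Γ C k).1 (fun l => ξ (l + 1)) = filterMsg A Γ C ξ k := by
  change filterMsg A Γ C (fun l => if l - 1 < k then ξ (l - 1 + 1) else 0) k = _
  refine filterMsg_congr hk fun l h1 h2 => ?_
  rw [if_pos (by omega)]
  simp only [Nat.sub_add_cancel h1]

lemma messages_filterPolicy {Ω : Type*} {m : ℕ} (x : ℕ → Ω → EuclideanSpace ℝ (Fin p))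
    {η : SenderProfile m p} {i : Fin m} (hη : η i = filterPolicy A Γ C) {k : ℕ} (ω : Ω)
    (j : Fin k) : messages x η k ω j i = filterMsg A Γ C (fun l => x l ω) (j + 1) := by
  rw [messages, hη]
  exact filterPolicy_apply (ξ := fun l => x l ω) (by omega)

/-- Because the gain factors through `C`, the correction uses the innovation only through the
message, so the receiver can run the filter. -/
lemma filterEst_succ_eq {D : ℕ → Matrix (Fin p) (Fin p) ℝ} {k : ℕ}
    (hD : Γ (k + 1) = D (k + 1) * C (k + 1)) (ξ : ℕ → EuclideanSpace ℝ (Fin p)) :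
    filterEst A Γ ξ (k + 1) = Matrix.toEuclideanLin A (filterEst A Γ ξ k) +
      Matrix.toEuclideanLin (D (k + 1)) (filterMsg A Γ C ξ (k + 1)) := by
  rw [filterEst, hD, toEuclideanLin_mul_apply]
  rfl

/-- The estimates are functions of the messages. -/
lemma measurable_filterEst_comap_messages {Ω : Type*} {m : ℕ}
    (x : ℕ → Ω → EuclideanSpace ℝ (Fin p)) {η : SenderProfile m p} {i : Fin m}
    (hη : η i = filterPolicy A Γ C) {D : ℕ → Matrix (Fin p) (Fin p) ℝ} {k n : ℕ}
    (hD : ∀ l ∈ Finset.Icc 1 n, Γ l = D l * C l) (hk : k ≤ n) {l : ℕ} (hl : l ≤ k) :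
    Measurable[MeasurableSpace.comap (messages x η k) inferInstance]
      (fun ω => filterEst A Γ (fun l => x l ω) l) := by
  induction l with
  | zero => exact measurable_const
  | succ l ih =>
    simp_rw [filterEst_succ_eq (hD (l + 1) (Finset.mem_Icc.2 ⟨by omega, by omega⟩))]
    refine ((measurable_toEuclideanLin _).comp (ih (by omega))).add
      ((measurable_toEuclideanLin _).comp ?_)
    have h1 : (fun ω => filterMsg A Γ C (fun l => x l ω) (l + 1)) =
        (fun y : Fin k → Fin m → EuclideanSpace ℝ (Fin p) => y ⟨l, hl⟩ i) ∘ messages x η k :=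
      funext fun ω => (messages_filterPolicy x hη ω ⟨l, hl⟩).symm
    rw [h1]
    exact (((measurable_pi_apply i).comp (measurable_pi_apply (⟨l, hl⟩ : Fin k)))).comp
      (comap_measurable _)

/-- If one sender of `η'` sends what all senders of `η` send, then `η'` is more informative. -/
lemma comap_messages_le {Ω : Type*} {m : ℕ} (x : ℕ → Ω → EuclideanSpace ℝ (Fin p))
    {η η' : SenderProfile m p} {i : Fin m} (h : ∀ i', η i' = η' i) (k : ℕ) :
    MeasurableSpace.comap (messages x η k) inferInstance ≤
      MeasurableSpace.comap (messages x η' k) inferInstance := by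
  have h1 : messages x η k = (fun (y : Fin k → Fin m → EuclideanSpace ℝ (Fin p)) j _ => y j i) ∘
      messages x η' k := by
    ext ω j i' : 3
    simp only [messages, h i', Function.comp_apply]
  rw [h1]
  refine Measurable.comap_le (Measurable.comp ?_ (comap_measurable _))
  exact measurable_pi_lambda _ fun j => measurable_pi_lambda _ fun _ =>
    (measurable_pi_apply i).comp (measurable_pi_apply j)

end Filter

/-- `M^{1/2} P M^{-1/2}` is the optimal linear gain for an innovation of covariance `M` observed
through `P M^{-1/2}`. The first identity makes the residual uncorrelated with the message; the
second is the explained covariance. The hypothesis `hPE` handles singular `M`. -/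
lemma projection_gain {p : ℕ} {M P : Matrix (Fin p) (Fin p) ℝ} (hM : 0 ≤ M) (hPt : Pᵀ = P)
    (hPP : P * P = P) (hPE : P * (invSqrt M * CFC.sqrt M) = P) :
    (1 - CFC.sqrt M * P * (P * invSqrt M)) * M * (P * invSqrt M)ᵀ = 0 ∧
    CFC.sqrt M * P * (P * invSqrt M) * M = CFC.sqrt M * P * CFC.sqrt M := by
  have hHH := CFC.sqrt_mul_sqrt_self M hM
  have hIt := invSqrt_transpose M
  have hc := sqrt_mul_invSqrt_comm hM
  have hHIH := sqrt_mul_invSqrt_mul_sqrt hM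
  set H := CFC.sqrt M
  set I := invSqrt M
  have h2 : H * P * (P * I) * M = H * P * H := by
    calc H * P * (P * I) * M = H * ((P * P) * (I * H)) * H := by
          rw [← hHH]; simp only [mul_assoc]
      _ = H * P * H := by rw [hPP, hPE]
  refine ⟨?_, h2⟩
  rw [sub_mul, sub_mul, h2, Matrix.transpose_mul, hIt, hPt, one_mul, sub_eq_zero]
  have hEP : I * H * P = P := by
    have := congrArg Matrix.transpose hPE
    rwa [Matrix.transpose_mul, Matrix.transpose_mul, hPt, hIt, sqrt_transpose, hc] at this
  calc M * (I * P) = H * (H * I * P) := by rw [← hHH]; simp only [mul_assoc]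
    _ = H * (P * P) := by rw [hc, hEP, hPP]
    _ = H * P * (H * I * P) := by rw [hc, hEP, mul_assoc]
    _ = H * P * H * (I * P) := by simp only [mul_assoc]

/-! ### The filter in the Gauss–Markov model -/

namespace SignalingGame

variable {m p t q : ℕ} {G : SignalingGame m p t q}
variable {Ω F : Type*} [MeasurableSpace Ω] {μ : Measure Ω}
  [NormedAddCommGroup F] [NormedSpace ℝ F] [MeasurableSpace F]

/-- The states are linear functions of a centered Gaussian vector `Z`, with transitions driven by
noises `w` that are uncorrelated with the past. -/
structure IsLinearState (G : SignalingGame m p t q) (μ : Measure Ω)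
    (x w : ℕ → Ω → EuclideanSpace ℝ (Fin p)) (Z : Ω → F) : Prop where
  gaussian : HasGaussianLaw Z μ
  measurable : Measurable Z
  integral_eq_zero : ∫ ω, Z ω ∂μ = 0
  linear_state : ∀ k ≤ G.n, IsLinearIn Z (x k)
  linear_noise : ∀ k < G.n, IsLinearIn Z (w k)
  step : ∀ k < G.n, ∀ ω, x (k + 1) ω = Matrix.toEuclideanLin G.A (x k ω) + w k ω
  cov_zero : crossMoment μ (x 0) (x 0) = G.cov0
  cov_noise : ∀ k < G.n, crossMoment μ (w k) (w k) = G.covW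
  uncorrelated : ∀ k < G.n, ∀ l ≤ k, crossMoment μ (w k) (x l) = 0

/-- `Z` stacks `x_0` and all the noises, which are jointly Gaussian by independence. The state `x_l`
involves only the noises before stage `l`, hence is uncorrelated with `w_k` for `l ≤ k`. -/
lemma IsGaussMarkovState.exists_isLinearState [IsProbabilityMeasure μ]
    {x : ℕ → Ω → EuclideanSpace ℝ (Fin p)} (hx : G.IsGaussMarkovState μ x) :
    ∃ (w : ℕ → Ω → EuclideanSpace ℝ (Fin p))
      (Z : Ω → Fin (G.n + 1) → EuclideanSpace ℝ (Fin p)), G.IsLinearState μ x w Z := by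
  obtain ⟨w, hx0, hw, hlx, hlw, hind, hstep⟩ := hx
  set Z' : Fin (G.n + 1) → Ω → EuclideanSpace ℝ (Fin p) :=
    Fin.cons (x 0) (fun j : Fin G.n => w j) with hZ'
  have hm : ∀ i, Measurable (Z' i) :=
    Fin.cases hx0 (fun j => hw j j.2)
  have hg : ∀ i, HasGaussianLaw (Z' i) μ :=
    Fin.cases (hasGaussianLaw_of_map_eq hlx) (fun j => hasGaussianLaw_of_map_eq (hlw j j.2))
  have hi : ∀ i, ∫ ω, Z' i ω ∂μ = 0 :=
    Fin.cases (integral_eq_zero_of_map_eq hx0 hlx)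
      (fun j => integral_eq_zero_of_map_eq (hw j j.2) (hlw j j.2))
  have hG : HasGaussianLaw (fun ω => (Z' · ω)) μ := hind.hasGaussianLaw hg
  have hlin : ∀ i, IsLinearIn (fun ω => (Z' · ω)) (Z' i) := fun i =>
    ⟨ContinuousLinearMap.proj i, fun _ => rfl⟩
  have hlinw : ∀ k < G.n, IsLinearIn (fun ω => (Z' · ω)) (w k) := fun k hk => hlin ⟨k + 1, by omega⟩
  have hlinx : ∀ k ≤ G.n, IsLinearIn (fun ω => (Z' · ω)) (x k) := by
    intro k
    induction k with
    | zero => exact fun _ => hlin 0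
    | succ k ih =>
      intro hk
      rw [show x (k + 1) = _ from funext (hstep k hk)]
      exact ((ih (by omega)).toEuclideanLin _).add (hlinw k hk)
  have hL : ∀ {X : Ω → EuclideanSpace ℝ (Fin p)}, IsLinearIn (fun ω => (Z' · ω)) X →
      MemLp X 2 μ := fun h => (h.hasGaussianLaw hG).memLp_two
  -- The noise `w k` is the component `k + 1` of `Z`; component `0` is the initial state.
  have hww : ∀ k < G.n, ∀ i, i ≠ k + 1 → ∀ hi' : i < G.n + 1,
      crossMoment μ (w k) (Z' ⟨i, hi'⟩) = 0 := by
    intro k hk i hik hi'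
    refine crossMoment_of_indepFun (hL (hlinw k hk)) (hL (hlin _)) (hi ⟨k + 1, by omega⟩) ?_
    exact hind.indepFun (i := ⟨k + 1, by omega⟩) (j := ⟨i, hi'⟩)
      (by simpa [Fin.ext_iff] using Ne.symm hik)
  refine ⟨w, fun ω => (Z' · ω), hG, measurable_pi_lambda _ hm, ?_, hlinx, hlinw, hstep,
    crossMoment_of_map_eq hx0 G.cov0_posSemidef hlx,
    fun k hk => crossMoment_of_map_eq (hw k hk) G.covW_posSemidef (hlw k hk), ?_⟩
  · ext1 i
    have := (ContinuousLinearMap.proj (R := ℝ)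
      (φ := fun _ : Fin (G.n + 1) => EuclideanSpace ℝ (Fin p)) i).integral_comp_comm hG.integrable
    rw [Pi.zero_apply, ← hi i]
    exact this.symm
  · intro k hk l
    induction l with
    | zero =>
      intro _
      have := hww k hk 0 (by omega) (by omega)
      exact this
    | succ l ih =>
      intro hl
      rw [show x (l + 1) = _ from funext (hstep l (by omega)),
        crossMoment_add_right (hL (hlinw k hk))
          (memLp_toEuclideanLin (hL (hlinx l (by omega))) _) (hL (hlinw l (by omega))),
        crossMoment_lin_right (hL (hlinw k hk)) (hL (hlinx l (by omega))), ih (by omega),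
        Matrix.zero_mul, zero_add]
      exact hww k hk (l + 1) (by omega) (by omega)

namespace IsLinearState

variable {x w : ℕ → Ω → EuclideanSpace ℝ (Fin p)} {Z : Ω → F} (h : G.IsLinearState μ x w Z)
  {Γ C : ℕ → Matrix (Fin p) (Fin p) ℝ}
include h

lemma linear_filterEst {k : ℕ} (hk : k ≤ G.n) :
    IsLinearIn Z (fun ω => filterEst G.A Γ (fun l => x l ω) k) := by
  induction k with
  | zero => exact isLinearIn_zero
  | succ k ih =>
    have ih := ih (by omega)
    exact (ih.toEuclideanLin _).add
      (((h.linear_state _ hk).sub (ih.toEuclideanLin _)).toEuclideanLin _)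

lemma linear_filterMsg {k : ℕ} (hk : k ≤ G.n) :
    IsLinearIn Z (fun ω => filterMsg G.A Γ C (fun l => x l ω) k) :=
  ((h.linear_state _ hk).sub
    ((h.linear_filterEst (Nat.sub_le_of_le_add (by omega))).toEuclideanLin _)).toEuclideanLin _

variable [BorelSpace F]

lemma memLp {a : ℕ} {X : Ω → EuclideanSpace ℝ (Fin a)} (hX : IsLinearIn Z X) : MemLp X 2 μ :=
  (hX.hasGaussianLaw h.gaussian).memLp_two

lemma memLp_state {k : ℕ} (hk : k ≤ G.n) : MemLp (x k) 2 μ := h.memLp (h.linear_state k hk)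

lemma measurable_state {k : ℕ} (hk : k ≤ G.n) : Measurable (x k) :=
  (h.linear_state k hk).measurable h.measurable

lemma crossMoment_state {k : ℕ} (hk : k ≤ G.n) : crossMoment μ (x k) (x k) = G.stateCov k := by
  induction k with
  | zero => exact h.cov_zero
  | succ k ih =>
    have hx := h.memLp_state (k := k) (by omega)
    have hw := h.memLp (h.linear_noise k hk)
    have hAx := memLp_toEuclideanLin hx G.A
    have hsum : MemLp (fun ω => Matrix.toEuclideanLin G.A (x k ω) + w k ω) 2 μ := hAx.add hw
    have hwx := h.uncorrelated k hk k le_rfl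
    have hxw : crossMoment μ (x k) (w k) = 0 := by
      rw [← crossMoment_transpose, hwx, Matrix.transpose_zero]
    rw [show x (k + 1) = _ from funext (h.step k hk), crossMoment_add_left hAx hw hsum,
      crossMoment_add_right hAx hAx hw, crossMoment_add_right hw hAx hw,
      crossMoment_lin_left hx hAx, crossMoment_lin_right hx hx, crossMoment_lin_left hx hw, hxw,
      crossMoment_lin_right hw hx, hwx, h.cov_noise k hk, ih (by omega)]
    simp [stateCov, mul_assoc]

/-- What is uncorrelated with the states is uncorrelated with the estimates. -/
lemma crossMoment_filterEst_eq_zero {Y : Ω → EuclideanSpace ℝ (Fin p)} (hY : MemLp Y 2 μ) {k : ℕ}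
    (hk : k ≤ G.n) (hYx : ∀ l ≤ k, crossMoment μ Y (x l) = 0) {l : ℕ} (hl : l ≤ k) :
    crossMoment μ Y (fun ω => filterEst G.A Γ (fun l => x l ω) l) = 0 := by
  induction l with
  | zero => ext i j; simp [crossMoment, filterEst]
  | succ l ih =>
    have ih := ih (by omega)
    have he := h.memLp (h.linear_filterEst (Γ := Γ) (k := l) (by omega))
    have hx := h.memLp_state (k := l + 1) (by omega)
    have hAe := memLp_toEuclideanLin he G.A
    have hd := hx.sub hAe
    have e1 := crossMoment_add_right hY hAe (memLp_toEuclideanLin hd (Γ (l + 1)))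
    have e2 := crossMoment_lin_right hY hd (Γ (l + 1))
    have e3 := crossMoment_sub_right hY hx hAe
    have e4 := crossMoment_lin_right hY he G.A
    rw [ih, Matrix.zero_mul] at e4
    rw [hYx _ hl, e4, sub_zero] at e3
    have e3' : crossMoment μ Y (x (l + 1) - fun ω =>
      Matrix.toEuclideanLin G.A (filterEst G.A Γ (fun l => x l ω) l)) = 0 := e3
    rw [e3', Matrix.zero_mul] at e2
    rw [e2, e4, add_zero] at e1
    exact e1

lemma crossMoment_filterMsg_eq_zero {Y : Ω → EuclideanSpace ℝ (Fin p)} (hY : MemLp Y 2 μ) {k : ℕ}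
    (hk : k ≤ G.n) (hYx : ∀ l ≤ k, crossMoment μ Y (x l) = 0) {l : ℕ} (hl : l ≤ k) :
    crossMoment μ Y (fun ω => filterMsg G.A Γ C (fun l => x l ω) l) = 0 := by
  have he := h.memLp (h.linear_filterEst (Γ := Γ) (k := l - 1) (by omega))
  have hx := h.memLp_state (k := l) (by omega)
  have hAe := memLp_toEuclideanLin he G.A
  have hd : MemLp (fun ω => x l ω -
    Matrix.toEuclideanLin G.A (filterEst G.A Γ (fun l => x l ω) (l - 1))) 2 μ := hx.sub hAe
  have e2 := crossMoment_lin_right hY hd (C l)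
  rw [crossMoment_sub_right hY hx hAe, crossMoment_lin_right hY he,
    h.crossMoment_filterEst_eq_zero hY hk hYx (by omega), hYx l hl, Matrix.zero_mul, sub_zero,
    Matrix.zero_mul] at e2
  exact e2

variable {S : ℕ → Matrix (Fin p) (Fin p) ℝ}

/-- The estimation errors of the filter: their covariance is `Σ_k - S_k`, and they are uncorrelated
with the messages sent so far. -/
lemma filter_error (hS0 : S 0 = 0)
    (hgain : ∀ k ∈ Finset.Icc 1 G.n,
      (1 - Γ k) * (G.stateCov k - G.A * S (k - 1) * G.Aᵀ) * (C k)ᵀ = 0)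
    {D : ℕ → Matrix (Fin p) (Fin p) ℝ} (hD : ∀ k ∈ Finset.Icc 1 G.n, Γ k = D k * C k)
    (hS : ∀ k ∈ Finset.Icc 1 G.n, S k = G.A * S (k - 1) * G.Aᵀ +
      Γ k * (G.stateCov k - G.A * S (k - 1) * G.Aᵀ)) {k : ℕ} (hk : k ≤ G.n) :
    crossMoment μ (fun ω => x k ω - filterEst G.A Γ (fun l => x l ω) k)
        (fun ω => x k ω - filterEst G.A Γ (fun l => x l ω) k) = G.stateCov k - S k ∧
      ∀ l, 1 ≤ l → l ≤ k → crossMoment μ (fun ω => x k ω - filterEst G.A Γ (fun l => x l ω) k)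
        (fun ω => filterMsg G.A Γ C (fun l => x l ω) l) = 0 := by
  induction k with
  | zero =>
    refine ⟨?_, fun l h1 h2 => by omega⟩
    simp only [filterEst, sub_zero, hS0]
    exact h.cov_zero
  | succ k ih =>
    obtain ⟨ih1, ih2⟩ := ih (by omega)
    have hmem : k + 1 ∈ Finset.Icc 1 G.n := Finset.mem_Icc.2 ⟨by omega, hk⟩
    have hSk := hS _ hmem
    have hg := hgain _ hmem
    simp only [Nat.add_sub_cancel] at hSk hg
    set N := G.stateCov (k + 1) - G.A * S k * G.Aᵀ with hN
    set est : Ω → EuclideanSpace ℝ (Fin p) := fun ω => filterEst G.A Γ (fun l => x l ω) k with hest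
    set ε : Ω → EuclideanSpace ℝ (Fin p) := fun ω => x k ω - est ω with hε
    -- `e` is the innovation `x_{k+1} - A z_k = A ε_k + w_k`. The new error is `(1 - Γ) e` and the
    -- new message is `C e`.
    set e : Ω → EuclideanSpace ℝ (Fin p) := fun ω => Matrix.toEuclideanLin G.A (ε ω) + w k ω with he
    have hwL := h.memLp (h.linear_noise k hk)
    have hestlin : IsLinearIn Z est := h.linear_filterEst (by omega)
    have hεlin : IsLinearIn Z ε := (h.linear_state k (by omega)).sub hestlin
    have hεL := h.memLp hεlin
    have hAε := memLp_toEuclideanLin hεL G.A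
    have heL : MemLp e 2 μ := hAε.add hwL
    have he_eq : ∀ ω, x (k + 1) ω - Matrix.toEuclideanLin G.A (est ω) = e ω := by
      intro ω
      simp only [he, hε, h.step k hk ω, map_sub]
      abel
    have herr : (fun ω => x (k + 1) ω - filterEst G.A Γ (fun l => x l ω) (k + 1)) =
        fun ω => Matrix.toEuclideanLin (1 - Γ (k + 1)) (e ω) := by
      ext1 ω
      rw [filterEst, show filterEst G.A Γ (fun l => x l ω) k = est ω from rfl, he_eq,
        ← sub_sub, he_eq, map_sub, LinearMap.sub_apply, toEuclideanLin_one_apply]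
    have hmsg : (fun ω => filterMsg G.A Γ C (fun l => x l ω) (k + 1)) =
        fun ω => Matrix.toEuclideanLin (C (k + 1)) (e ω) := by
      ext1 ω
      rw [← he_eq ω]
      rfl
    have hwx : ∀ l ≤ k, crossMoment μ (w k) (x l) = 0 := h.uncorrelated k hk
    have hwε : crossMoment μ (w k) ε = 0 := by
      rw [crossMoment_sub_right hwL (h.memLp_state (by omega)) (h.memLp hestlin), hwx k le_rfl,
        h.crossMoment_filterEst_eq_zero hwL (by omega) hwx le_rfl, sub_zero]
    have hεw : crossMoment μ ε (w k) = 0 := by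
      rw [← crossMoment_transpose, hwε, Matrix.transpose_zero]
    have hee : crossMoment μ e e = N := by
      rw [crossMoment_add_left hAε hwL heL, crossMoment_add_right hAε hAε hwL,
        crossMoment_add_right hwL hAε hwL, crossMoment_lin_left hεL hAε,
        crossMoment_lin_right hεL hεL, crossMoment_lin_left hεL hwL, hεw,
        crossMoment_lin_right hwL hεL, hwε, h.cov_noise k hk, ih1, hN, stateCov]
      simp only [Matrix.mul_zero, Matrix.zero_mul, add_zero, zero_add, mul_sub, sub_mul,
        mul_assoc]
      abel
    rw [herr]
    refine ⟨?_, fun l h1 h2 => ?_⟩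
    -- As `Γᵀ = Cᵀ Dᵀ`, the gain condition reduces `(1 - Γ) N (1 - Γ)ᵀ` to `(1 - Γ) N`.
    · rw [crossMoment_lin_left heL (memLp_toEuclideanLin heL _), crossMoment_lin_right heL heL, hee,
        Matrix.transpose_sub, Matrix.transpose_one, hD _ hmem, Matrix.transpose_mul, ← hD _ hmem,
        ← mul_assoc, mul_sub, ← mul_assoc _ (C (k + 1))ᵀ, hg, Matrix.zero_mul, sub_zero, mul_one,
        hSk, sub_mul, one_mul, hN]
      abel
    · rcases Nat.lt_or_ge l (k + 1) with hl | hl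
      · have hml := h.memLp (h.linear_filterMsg (Γ := Γ) (C := C) (k := l) (by omega))
        rw [crossMoment_lin_left heL hml, crossMoment_add_left hAε hwL hml,
          crossMoment_lin_left hεL hml, ih2 l h1 (by omega),
          h.crossMoment_filterMsg_eq_zero hwL (by omega) hwx (by omega)]
        simp
      · obtain rfl : l = k + 1 := le_antisymm h2 hl
        rw [hmsg, crossMoment_lin_left heL (memLp_toEuclideanLin heL _),
          crossMoment_lin_right heL heL, hee, ← mul_assoc, hg]

/-- The filtering policy induces the posterior covariances `S k`. -/
lemma posteriorCov_filterPolicy [CompleteSpace F] [SecondCountableTopology F]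
    [IsProbabilityMeasure μ] (hm : 0 < m) (hS0 : S 0 = 0)
    (hgain : ∀ k ∈ Finset.Icc 1 G.n,
      (1 - Γ k) * (G.stateCov k - G.A * S (k - 1) * G.Aᵀ) * (C k)ᵀ = 0)
    {D : ℕ → Matrix (Fin p) (Fin p) ℝ} (hD : ∀ k ∈ Finset.Icc 1 G.n, Γ k = D k * C k)
    (hS : ∀ k ∈ Finset.Icc 1 G.n, S k = G.A * S (k - 1) * G.Aᵀ +
      Γ k * (G.stateCov k - G.A * S (k - 1) * G.Aᵀ)) {k : ℕ} (hk : k ≤ G.n) :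
    posteriorCov μ x (fun _ : Fin m => filterPolicy G.A Γ C) k = S k := by
  set η : SenderProfile m p := fun _ => filterPolicy G.A Γ C with hη
  obtain ⟨h1, h2⟩ := h.filter_error hS0 hgain hD hS hk
  set est : Ω → EuclideanSpace ℝ (Fin p) := fun ω => filterEst G.A Γ (fun l => x l ω) k with hest
  set ε : Ω → EuclideanSpace ℝ (Fin p) := fun ω => x k ω - est ω with hε
  have hxL := h.memLp_state hk
  have hestlin : IsLinearIn Z est := h.linear_filterEst hk
  have hεlin : IsLinearIn Z ε := (h.linear_state k hk).sub hestlin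
  have hestL := h.memLp hestlin
  have hεL := h.memLp hεlin
  have hmeas : Measurable (messages x η k) :=
    measurable_messages fun l hl => h.measurable_state (hl.trans hk)
  have hestm : Measurable[MeasurableSpace.comap (messages x η k) inferInstance] est :=
    measurable_filterEst_comap_messages x (i := ⟨0, hm⟩) rfl hD hk le_rfl
  have hmsg : ∀ j i, (fun ω => messages x η k ω j i) =
      fun ω => filterMsg G.A Γ C (fun l => x l ω) (j + 1) := fun j i =>
    funext fun ω => messages_filterPolicy x rfl ω j
  -- Errors uncorrelated with the messages are independent of them by Gaussianity, so the filter
  -- output is the conditional expectation.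
  have hcond : μ[ε | MeasurableSpace.comap (messages x η k) inferInstance] =ᵐ[μ] 0 := by
    refine condExp_eq_zero_of_crossMoment_eq_zero h.gaussian h.measurable h.integral_eq_zero hεlin
      (fun j i => ?_) fun j i => ?_
    · rw [hmsg]
      exact h.linear_filterMsg (by omega)
    · rw [hmsg]
      exact h2 _ (by omega) (by omega)
  have hestimate : estimate μ x η k =ᵐ[μ] est := by
    have e1 := condExp_sub (hxL.integrable (by norm_num)) (hestL.integrable (by norm_num))
      (MeasurableSpace.comap (messages x η k) inferInstance)
    have e2 := condExp_of_stronglyMeasurable hmeas.comap_le hestm.stronglyMeasurable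
      (hestL.integrable (by norm_num))
    filter_upwards [e1, hcond] with ω a b
    rw [show x k - est = ε from rfl, b, Pi.sub_apply, e2] at a
    exact (sub_eq_zero.1 a.symm)
  have hpost : posteriorCov μ x η k = crossMoment μ est est := by
    rw [posteriorCov_eq, crossMoment_congr_left hestimate, crossMoment_congr_right hestimate]
  have hxe : crossMoment μ (x k) est = crossMoment μ est est := by
    rw [← crossMoment_congr_right hestimate, crossMoment_state_estimate
      (fun l hl => h.measurable_state (hl.trans hk)) hxL, hpost]
  have hex : crossMoment μ est (x k) = crossMoment μ est est := by
    rw [← crossMoment_transpose, hxe, crossMoment_transpose]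
  rw [hpost]
  rw [crossMoment_sub_left hxL hestL hεL, crossMoment_sub_right hxL hxL hestL,
    crossMoment_sub_right hestL hxL hestL, hxe, hex, h.crossMoment_state hk, sub_self,
    sub_zero] at h1
  exact sub_right_injective h1

end IsLinearState

end SignalingGame

/-! ### Equilibrium -/

namespace SignalingGame

variable {m p t q : ℕ} {G : SignalingGame m p t q}
variable {Ω F : Type*} [MeasurableSpace Ω] {μ : Measure Ω}
  [NormedAddCommGroup F] [NormedSpace ℝ F] [MeasurableSpace F] [BorelSpace F]
  {x w : ℕ → Ω → EuclideanSpace ℝ (Fin p)} {Z : Ω → F}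

/-- If all senders use the same policy and its posterior at stage `k` is stage-stable for sender
`i`, then no deviation of sender `i` lowers its cost at stage `k`. -/
lemma IsLinearState.stageCost_le_deviation [IsProbabilityMeasure μ]
    (h : G.IsLinearState μ x w Z) (hm : 2 ≤ m) {η : SenderProfile m p}
    (hη : ∀ i j, η i = η j) {k : ℕ}
    (hk : k ≤ G.n) {i : Fin m} (hstable : G.IsStageStable i k (posteriorCov μ x η k))
    (e : SenderPolicy p) {g g' : ReceiverPolicy m p t} (hg : G.RespondsTo μ x η g)
    (hg' : G.RespondsTo μ x (Function.update η i e) g') :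
    G.stageCost μ x (some i) k (fun ω => (g k).1 (messages x η k ω)) ≤
      G.stageCost μ x (some i) k
        (fun ω => (g' k).1 (messages x (Function.update η i e) k ω)) := by
  have hmes : ∀ l ≤ k, Measurable (x l) := fun l hl => h.measurable_state (hl.trans hk)
  have hxL := h.memLp_state hk
  -- Sender `j` keeps sending the common message, so the deviation leaves the receiver at least as
  -- well informed.
  obtain ⟨j, hj⟩ : ∃ j : Fin m, j ≠ i := by
    have : Nontrivial (Fin m) := Fin.nontrivial_iff_two_le.2 hm
    exact exists_ne i
  have hle := posteriorCov_mono (μ := μ) (η := η)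
    (η' := Function.update η i e) hmes hxL
    (comap_messages_le x (i := j) (fun i' => by rw [Function.update_of_ne hj, hη i' j]) k)
  have hle' := posteriorCov_le (μ := μ) (η := Function.update η i e) hmes hxL
  rw [h.crossMoment_state hk] at hle'
  rw [hg.stageCost_sender hmes hxL i, hg'.stageCost_sender hmes hxL i]
  exact ENNReal.ofReal_le_ofReal (add_le_add le_rfl (hstable.2.2.2 _ hle hle'))

/-- Greedy posteriors are posteriors of an equilibrium, in which moreover no deviation lowers the
cost of the remaining stages. -/
lemma IsGreedy.exists_equilibrium [CompleteSpace F] [SecondCountableTopology F]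
    [IsProbabilityMeasure μ] (h : G.IsLinearState μ x w Z) (hm : 2 ≤ m)
    {σ : ℕ → Equiv.Perm (Fin m)} {S : ℕ → Matrix (Fin p) (Fin p) ℝ} (hS : G.IsGreedy σ S) :
    ∃ (η : SenderProfile m p) (γ : SenderProfile m p → ReceiverPolicy m p t),
      G.IsEquilibrium μ x η γ ∧
      (∀ k ∈ Finset.Icc 1 G.n, posteriorCov μ x η k = S k) ∧
      (∀ k ∈ Finset.Icc 1 G.n, ∀ (i : Fin m) (e : SenderPolicy p),
        G.cost μ x (some i) (Finset.Icc k G.n) η (γ η) ≤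
          G.cost μ x (some i) (Finset.Icc k G.n) (Function.update η i e)
            (γ (Function.update η i e))) := by
  obtain ⟨P, hP⟩ := hS.exists_projection
  let M : ℕ → Matrix (Fin p) (Fin p) ℝ := fun k => G.stateCov k - G.A * S (k - 1) * G.Aᵀ
  let C : ℕ → Matrix (Fin p) (Fin p) ℝ := fun k => P k * invSqrt (M k)
  let D : ℕ → Matrix (Fin p) (Fin p) ℝ := fun k => CFC.sqrt (M k) * P k
  let f : SenderPolicy p := filterPolicy G.A (fun k => D k * C k) C
  have hgain : ∀ k ∈ Finset.Icc 1 G.n, (1 - D k * C k) * M k * (C k)ᵀ = 0 ∧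
      D k * C k * M k = CFC.sqrt (M k) * P k * CFC.sqrt (M k) := fun k hk =>
    projection_gain (hS.prior_nonneg hk) (hP k hk).1 (hP k hk).2.1 (hP k hk).2.2.1
  have hpost : ∀ k ∈ Finset.Icc 1 G.n, posteriorCov μ x (fun _ : Fin m => f) k = S k :=
    fun k hk => h.posteriorCov_filterPolicy (by omega) hS.1 (fun k hk => (hgain k hk).1)
      (fun _ _ => rfl) (fun k hk => (hP k hk).2.2.2.trans (by rw [(hgain k hk).2]))
      (Finset.mem_Icc.1 hk).2
  choose γ hγ using G.exists_respondsTo μ x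
  have hmes : ∀ l ≤ G.n, Measurable (x l) := fun l hl => h.measurable_state hl
  -- Deviations are compared stage by stage, so any set of stages works: initial segments for the
  -- equilibrium, final segments for the remaining costs.
  have hdev : ∀ s ⊆ Finset.Icc 1 G.n, ∀ (i : Fin m) (e : SenderPolicy p),
      G.cost μ x (some i) s (fun _ => f) (γ fun _ => f) ≤
        G.cost μ x (some i) s (Function.update (fun _ => f) i e)
          (γ (Function.update (fun _ => f) i e)) := by
    intro s hs i e
    have hs' : ∀ k ∈ s, k ≤ G.n := fun k hk => (Finset.mem_Icc.1 (hs hk)).2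
    rw [cost_eq_sum_stageCost hmes _ hs', cost_eq_sum_stageCost hmes _ hs']
    refine Finset.sum_le_sum fun k hk => ?_
    refine h.stageCost_le_deviation hm (fun _ _ => rfl) (hs' k hk) ?_ e (hγ _) (hγ _)
    rw [hpost k (hs hk)]
    exact hS.isStageStable (hs hk) i
  refine ⟨fun _ => f, γ, ⟨fun k hk η' g => ?_, fun k hk i e => hdev _ ?_ i e⟩, hpost,
    fun k hk i e => hdev _ ?_ i e⟩
  · have hkn := (Finset.mem_Icc.1 hk).2
    have hs : ∀ l ∈ Finset.Icc 1 k, l ≤ G.n := fun l hl => (Finset.mem_Icc.1 hl).2.trans hkn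
    rw [cost_eq_sum_stageCost hmes _ hs, cost_eq_sum_stageCost hmes _ hs]
    refine Finset.sum_le_sum fun l hl => ?_
    exact (hγ η').stageCost_le (Finset.mem_Icc.2 ⟨(Finset.mem_Icc.1 hl).1, hs l hl⟩)
      (fun j hj => hmes j (hj.trans (hs l hl))) (h.memLp_state (hs l hl)) g
  · exact Finset.Icc_subset_Icc_right (Finset.mem_Icc.1 hk).2
  · exact Finset.Icc_subset_Icc_left (Finset.mem_Icc.1 hk).1

end SignalingGame

theorem lemma8 {m p t q : ℕ} (hm : 2 ≤ m) (G : SignalingGame m p t q)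
    {Ω : Type*} [MeasurableSpace Ω] (μ : Measure Ω) [IsProbabilityMeasure μ]
    (x : ℕ → Ω → EuclideanSpace ℝ (Fin p)) (hx : G.IsGaussMarkovState μ x) :
    (∀ σ : ℕ → Equiv.Perm (Fin m), ∃ S, G.IsGreedy σ S) ∧
    (∀ (σ : ℕ → Equiv.Perm (Fin m)) (S : ℕ → Matrix (Fin p) (Fin p) ℝ), G.IsGreedy σ S →
      (∃ P : ℕ → Matrix (Fin p) (Fin p) ℝ, ∀ k ∈ Finset.Icc 1 G.n, IsStarProjection (P k) ∧
        S k = G.A * S (k - 1) * G.Aᵀ +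
          CFC.sqrt (G.stateCov k - G.A * S (k - 1) * G.Aᵀ) * P k *
            CFC.sqrt (G.stateCov k - G.A * S (k - 1) * G.Aᵀ)) ∧
      (∃ (η : SenderProfile m p) (γ : SenderProfile m p → ReceiverPolicy m p t),
        G.IsEquilibrium μ x η γ ∧
        (∀ k ∈ Finset.Icc 1 G.n, posteriorCov μ x η k = S k) ∧
        (∀ k ∈ Finset.Icc 1 G.n, ∀ (i : Fin m) (e : SenderPolicy p),
          G.cost μ x (some i) (Finset.Icc k G.n) η (γ η) ≤
            G.cost μ x (some i) (Finset.Icc k G.n) (Function.update η i e)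
              (γ (Function.update η i e)))) ∧
      (∀ k ∈ Finset.Icc 1 G.n, ∀ i : Fin m, G.IsStageStable i k (S k) ∧
        ∀ B, G.IsFloor B → G.IsCostToGoStable B i k (S k))) ∧
    (∀ k ∈ Finset.Icc 1 G.n, ∀ (i : Fin m) (T : Matrix (Fin p) (Fin p) ℝ),
      G.IsStageStable i k T → ∀ B, G.IsFloor B → G.IsCostToGoStable B i k T) := by
  refine ⟨G.exists_isGreedy, fun σ S hS => ⟨?_, ?_, fun k hk i => ?_⟩,
    fun k _ i T hT B hB => hT.isCostToGoStable hB⟩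
  · obtain ⟨P, hP⟩ := hS.exists_projection
    refine ⟨P, fun k hk => ⟨⟨(hP k hk).2.1, ?_⟩, (hP k hk).2.2.2⟩⟩
    rw [IsSelfAdjoint, Matrix.star_eq_conjTranspose,
      Matrix.conjTranspose_eq_transpose_of_trivial, (hP k hk).1]
  · obtain ⟨w, Z, h⟩ := hx.exists_isLinearState
    exact hS.exists_equilibrium h hm
  · exact ⟨hS.isStageStable hk i, fun B hB => (hS.isStageStable hk i).isCostToGoStable hB⟩
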